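/- Let $V$ be a complex vector space with basis $e_1,\dots,e_N$, let $\langle\,,\rangle$ be the non-degenerate symmetric bilinear form on $V$ with $\langle e_i,e_j\rangle=\delta_{i+j,N+1}$, and let $K=SO(V,\langle\,,\rangle)$. Let $\mathfrak g_1$ be the space of trace-zero endomorphisms of $V$ that are self-adjoint for $\langle\,,\rangle$, on which $K$ acts by conjugation, and let $\mathfrak g_1^{rs}\subset\mathfrak g_1$ be the set of elements with $N$ distinct eigenvalues. For a subspace $U\subset V$ let $U^\perp$ be its orthogonal complement for $\langle\,,\rangle$, and put $V^0_i=\operatorname{span}\{e_1,\dots,e_i\}$. Let $k$ be an integer with $1\le k\le\frac{N-1}{2}$. Let $P_k\subset K$ be the stabilizer of the flag $V^0_{k-1}\subset V^0_k$, and let $$E_k=\{x\in\mathfrak g_1: xV_k^0=0,\ x(V_k^0)^\perp\subset V_{k-1}^0\},\qquad O_k=\{x\in\mathfrak g_1: xV_k^0=0,\ x(V_{k-1}^0)^\perp\subset V_{k-1}^0\}.$$ Let $E_k^\perp$, $O_k^\perp$ be their orthogonal complements in $\mathfrak g_1$ for the trace form $(x,y)\mapsto\operatorname{tr}(xy)$,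 and let $$\operatorname{Hess}_k^{E,\perp}=K\times^{P_k}E_k^\perp,\qquad \operatorname{Hess}_k^{O,\perp}=K\times^{P_k}O_k^\perp,$$ with the maps to $\mathfrak g_1$ and to $K/P_k$ sending the class of $(g,y)$ to $gyg^{-1}$ and to $gP_k$; a point $gP_k$ of $K/P_k$ is identified with the isotropic flag $gV^0_{k-1}\subset gV^0_k$. For $m\ge1$ let $X_m\subset\mathfrak g_1^{rs}\times\mathbb P(V)$ be the closed subvariety of all $(s,\langle v\rangle)$ with $\langle s^iv,v\rangle=0$ for $i=0,\dots,m-1$. The group $K$ acts on all these varieties, compatibly with their maps to $\mathfrak g_1$. Then: 1. There is a $K$-equivariant isomorphism $X_{2k-1}\simeq\operatorname{Hess}_k^{O,\perp}|_{\mathfrak g_1^{rs}}$ of varieties over $\mathfrak g_1^{rs}$. 2. There is a $K$-equivariant isomorphism $X_{2k}\simeq\operatorname{Hess}_k^{E,\perp}|_{\mathfrak g_1^{rs}}$ of varieties over $\mathfrak g_1^{rs}$. In both cases the isomorphism can be chosen so that it sends $(s,\langle v\rangle)$ to the point over $s$ whose flag is $\operatorname{span}\{v,sv,\dots,s^{k-2}v\}\subset\operatorname{span}\{v,sv,\dots,s^{k-1}v\}$.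 -/

import Mathlib

/-! ### Varieties as spaces with functions

A complex variety is treated classically: a set with a topology and a sheaf of `ℂ`-algebras of
`ℂ`-valued functions (the regular functions). -/

/-- A topology on `X` together with a sheaf of `ℂ`-algebras of `ℂ`-valued functions.
For an open set `U`, `f ∈ regular U` means that the restriction of `f` to `U` is a regular function
on `U`; by `glue`, this depends only on `f` restricted to `U` and is a local condition. -/
structure FunctionSpace (X : Type*) extends TopologicalSpace X where
  regular : Set X → Subalgebra ℂ (X → ℂ)
  restrict : ∀ {U W : Set X}, IsOpen U → IsOpen W → W ⊆ U → ∀ f ∈ regular U, f ∈ regular W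
  glue : ∀ {U : Set X} {f : X → ℂ}, IsOpen U →
    (∀ a ∈ U, ∃ W, IsOpen W ∧ a ∈ W ∧ W ⊆ U ∧ ∃ g ∈ regular W, Set.EqOn f g W) → f ∈ regular U

namespace FunctionSpace

/-- Morphisms: continuous maps that pull regular functions back to regular functions. -/
structure IsMorphism {X Y : Type*} (A : FunctionSpace X) (A' : FunctionSpace Y)
    (φ : X → Y) : Prop where
  isOpen_preimage : ∀ U : Set Y, A'.IsOpen U → A.IsOpen (φ ⁻¹' U)
  regular_comp : ∀ U : Set Y, A'.IsOpen U → ∀ f ∈ A'.regular U, f ∘ φ ∈ A.regular (φ ⁻¹' U)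

/-- Isomorphisms: bijections that are morphisms in both directions. -/
structure IsIsomorphism {X Y : Type*} (A : FunctionSpace X) (A' : FunctionSpace Y)
    (φ : X ≃ Y) : Prop where
  hom : IsMorphism A A' φ
  inv : IsMorphism A' A φ.symm

/-- Polynomial functions on a complex vector space: the algebra generated by linear forms. -/
def polynomialFunctions (E : Type*) [AddCommGroup E] [Module ℂ E] : Subalgebra ℂ (E → ℂ) :=
  Algebra.adjoin ℂ (Set.range fun φ : Module.Dual ℂ E => (φ : E → ℂ))

/-- A vector space as an affine space: the Zariski topology, generated by the sets `{p ≠ 0}` with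
`p` polynomial, and the functions that are locally quotients of polynomial functions. -/
def affine (E : Type*) [AddCommGroup E] [Module ℂ E] : FunctionSpace E :=
  let τ : TopologicalSpace E :=
    TopologicalSpace.generateFrom {U | ∃ p ∈ polynomialFunctions E, U = {a | p a ≠ 0}}
  { toTopologicalSpace := τ
    regular := fun U =>
      { carrier := {f | ∀ a ∈ U, ∃ W, IsOpen W ∧ a ∈ W ∧
          ∃ p ∈ polynomialFunctions E, ∃ q ∈ polynomialFunctions E,
            ∀ b ∈ U, b ∈ W → q b ≠ 0 ∧ f b = p b / q b}
        mul_mem' := by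
          intro f g hf hg a ha
          obtain ⟨W, hW, haW, p, hp, q, hq, h⟩ := hf a ha
          obtain ⟨W', hW', haW', p', hp', q', hq', h'⟩ := hg a ha
          refine ⟨W ∩ W', hW.inter hW', ⟨haW, haW'⟩, p * p', mul_mem hp hp', q * q',
            mul_mem hq hq', fun b hb hbW =>
              ⟨mul_ne_zero (h b hb hbW.1).1 (h' b hb hbW.2).1, ?_⟩⟩
          simp only [Pi.mul_apply]
          rw [(h b hb hbW.1).2, (h' b hb hbW.2).2, div_mul_div_comm]
        add_mem' := by
          intro f g hf hg a ha
          obtain ⟨W, hW, haW, p, hp, q, hq, h⟩ := hf a ha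
          obtain ⟨W', hW', haW', p', hp', q', hq', h'⟩ := hg a ha
          refine ⟨W ∩ W', hW.inter hW', ⟨haW, haW'⟩, p * q' + q * p',
            add_mem (mul_mem hp hq') (mul_mem hq hp'), q * q',
            mul_mem hq hq', fun b hb hbW =>
              ⟨mul_ne_zero (h b hb hbW.1).1 (h' b hb hbW.2).1, ?_⟩⟩
          simp only [Pi.mul_apply, Pi.add_apply]
          rw [(h b hb hbW.1).2, (h' b hb hbW.2).2,
            div_add_div _ _ (h b hb hbW.1).1 (h' b hb hbW.2).1]
        algebraMap_mem' := fun c a _ =>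
          ⟨Set.univ, isOpen_univ, Set.mem_univ a, algebraMap ℂ (E → ℂ) c,
            Subalgebra.algebraMap_mem _ c, 1, one_mem _, fun b _ _ => by simp⟩ }
    restrict := by
      intro U W _ _ hWU f hf a ha
      obtain ⟨O, hO, haO, p, hp, q, hq, h⟩ := hf a (hWU ha)
      exact ⟨O, hO, haO, p, hp, q, hq, fun b hb hbO => h b (hWU hb) hbO⟩
    glue := by
      intro U f _ h a ha
      obtain ⟨W, hW, haW, _, g, hg, hfg⟩ := h a ha
      obtain ⟨O, hO, haO, p, hp, q, hq, h'⟩ := hg a haW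
      refine ⟨O ∩ W, hO.inter hW, ⟨haO, haW⟩, p, hp, q, hq, fun b _ hb => ?_⟩
      rw [hfg hb.2]
      exact h' b hb.2 hb.1 }

/-- The structure of a subspace, given by an injective map `ι : S → X`: the induced topology, and
the functions that are locally restrictions of regular functions on open subsets of `X`. For a
locally closed subset of a variety this is the reduced subvariety structure. -/
def induced {S X : Type*} (ι : S → X) (A : FunctionSpace X) : FunctionSpace S :=
  let τ : TopologicalSpace S := TopologicalSpace.induced ι A.toTopologicalSpace
  { toTopologicalSpace := τ
    regular := fun U =>
      { carrier := {f | ∀ a ∈ U, ∃ W, A.IsOpen W ∧ ι a ∈ W ∧ ∃ F ∈ A.regular W,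
          ∀ b ∈ U, ι b ∈ W → f b = F (ι b)}
        mul_mem' := by
          intro f g hf hg a ha
          obtain ⟨W, hW, haW, F, hF, h⟩ := hf a ha
          obtain ⟨W', hW', haW', F', hF', h'⟩ := hg a ha
          have hi := A.isOpen_inter W W' hW hW'
          refine ⟨W ∩ W', hi, ⟨haW, haW'⟩, F * F',
            mul_mem (A.restrict hW hi Set.inter_subset_left F hF)
              (A.restrict hW' hi Set.inter_subset_right F' hF'), fun b hb hbW => ?_⟩
          simp only [Pi.mul_apply]
          rw [h b hb hbW.1, h' b hb hbW.2]
        add_mem' := by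
          intro f g hf hg a ha
          obtain ⟨W, hW, haW, F, hF, h⟩ := hf a ha
          obtain ⟨W', hW', haW', F', hF', h'⟩ := hg a ha
          have hi := A.isOpen_inter W W' hW hW'
          refine ⟨W ∩ W', hi, ⟨haW, haW'⟩, F + F',
            add_mem (A.restrict hW hi Set.inter_subset_left F hF)
              (A.restrict hW' hi Set.inter_subset_right F' hF'), fun b hb hbW => ?_⟩
          simp only [Pi.add_apply]
          rw [h b hb hbW.1, h' b hb hbW.2]
        algebraMap_mem' := fun c a _ =>
          ⟨Set.univ, A.isOpen_univ, Set.mem_univ _, algebraMap ℂ (X → ℂ) c,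
            Subalgebra.algebraMap_mem _ c, fun b _ _ => by simp⟩ }
    restrict := by
      intro U W _ _ hWU f hf a ha
      obtain ⟨O, hO, haO, F, hF, h⟩ := hf a (hWU ha)
      exact ⟨O, hO, haO, F, hF, fun b hb hbO => h b (hWU hb) hbO⟩
    glue := by
      intro U f _ h a ha
      obtain ⟨W, ⟨W₀, hW₀, hWW₀⟩, haW, _, g, hg, hfg⟩ := h a ha
      subst hWW₀
      obtain ⟨O, hO, haO, F, hF, h'⟩ := hg a haW
      have hi := A.isOpen_inter O W₀ hO hW₀
      refine ⟨O ∩ W₀, hi, ⟨haO, haW⟩, F, A.restrict hO hi Set.inter_subset_left F hF,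
        fun b _ hb => ?_⟩
      rw [hfg (show b ∈ ι ⁻¹' W₀ from hb.2)]
      exact h' b hb.2 hb.1 }

/-- The quotient structure along a surjective map `π : X → Y`: a set is open, respectively a
function is regular, if and only if its pullback to `X` is. -/
def coinduced {X Y : Type*} (π : X → Y) (A : FunctionSpace X) : FunctionSpace Y :=
  let τ : TopologicalSpace Y := TopologicalSpace.coinduced π A.toTopologicalSpace
  { toTopologicalSpace := τ
    regular := fun U =>
      { carrier := {f | f ∘ π ∈ A.regular (π ⁻¹' U)}
        mul_mem' := fun {f g} hf hg =>
          (A.regular (π ⁻¹' U)).mul_mem' (a := f ∘ π) (b := g ∘ π) hf hg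
        add_mem' := fun {f g} hf hg =>
          (A.regular (π ⁻¹' U)).add_mem' (a := f ∘ π) (b := g ∘ π) hf hg
        algebraMap_mem' := fun c => Subalgebra.algebraMap_mem (A.regular (π ⁻¹' U)) c }
    restrict := fun hU hW hWU f hf => A.restrict hU hW (Set.preimage_mono hWU) (f ∘ π) hf
    glue := by
      intro U f hU h
      refine A.glue hU fun a ha => ?_
      obtain ⟨W, hW, haW, hWU, g, hg, hfg⟩ := h (π a) ha
      exact ⟨π ⁻¹' W, hW, haW, Set.preimage_mono hWU, g ∘ π, hg, fun b hb => hfg hb⟩ }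

/-- The product of the affine space `E` and the projective space of `V`, as the quotient of
`E × (V ∖ 0)` by the scalars acting on `V`. -/
noncomputable def affineProjective (E V : Type*) [AddCommGroup E] [Module ℂ E] [AddCommGroup V] [Module ℂ V] :
    FunctionSpace (E × Projectivization ℂ V) :=
  coinduced
    (fun p : {p : E × V // p.2 ≠ 0} => (p.1.1, Projectivization.mk ℂ p.1.2 p.2))
    (induced Subtype.val (affine (E × V)))

end FunctionSpace

/-! ### The symmetric pair `(SL(V), SO(V))` -/

namespace SplitPair

variable {V : Type*} [AddCommGroup V] [Module ℂ V]

/-- The group `K = SO(V, B)`. -/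
def SO (B : LinearMap.BilinForm ℂ V) : Subgroup (V ≃ₗ[ℂ] V) where
  carrier := {g | (∀ u v, B (g u) (g v) = B u v) ∧ LinearMap.det (g : V →ₗ[ℂ] V) = 1}
  one_mem' := ⟨fun _ _ => rfl, LinearMap.det_id⟩
  mul_mem' := by
    rintro g h ⟨hg, hg'⟩ ⟨hh, hh'⟩
    refine ⟨fun u v => ?_, ?_⟩
    · simp only [LinearEquiv.mul_apply, hg, hh]
    · have : ((g * h : V ≃ₗ[ℂ] V) : V →ₗ[ℂ] V) = (g : V →ₗ[ℂ] V) ∘ₗ (h : V →ₗ[ℂ] V) := rfl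
      rw [this, LinearMap.det_comp, hg', hh', one_mul]
  inv_mem' := by
    rintro g ⟨hg, hg'⟩
    refine ⟨fun u v => ?_, ?_⟩
    · rw [← hg, ← LinearEquiv.mul_apply, ← LinearEquiv.mul_apply, mul_inv_cancel]
      rfl
    · have h : ((g : V →ₗ[ℂ] V) ∘ₗ ((g⁻¹ : V ≃ₗ[ℂ] V) : V →ₗ[ℂ] V)) = LinearMap.id := by
        ext v
        change (g * g⁻¹) v = v
        rw [mul_inv_cancel]
        rfl
      have h' := congrArg LinearMap.det h
      rwa [LinearMap.det_comp, hg', one_mul, LinearMap.det_id] at h'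

/-- `𝔤₁`: the trace-zero endomorphisms that are self-adjoint for `B`, that is, the `(-1)`-eigenspace
in `𝔰𝔩(V)` of the involution `x ↦ -x*` with fixed algebra `𝔰𝔬(V, B)`. -/
def g1 (B : LinearMap.BilinForm ℂ V) : Submodule ℂ (Module.End ℂ V) where
  carrier := {x | LinearMap.trace ℂ V x = 0 ∧ ∀ u v, B (x u) v = B u (x v)}
  zero_mem' := by simp
  add_mem' := by
    rintro x y ⟨hx, hx'⟩ ⟨hy, hy'⟩
    exact ⟨by simp [hx, hy], fun u v => by simp [hx', hy']⟩
  smul_mem' := by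
    rintro c x ⟨hx, hx'⟩
    exact ⟨by simp [hx], fun u v => by simp [hx']⟩

/-- `𝔤₁^{rs}`: the regular semisimple elements of `𝔤₁`, that is, those with `dim V` distinct
eigenvalues. -/
def g1rs (B : LinearMap.BilinForm ℂ V) : Set (Module.End ℂ V) :=
  {x | x ∈ g1 B ∧ {μ : ℂ | Module.End.HasEigenvalue x μ}.ncard = Module.finrank ℂ V}

/-- The standard flag: the span of the first `l` basis vectors. -/
def stdFlag {N : ℕ} (e : Module.Basis (Fin N) ℂ V) (l : ℕ) : Submodule ℂ V :=
  Submodule.span ℂ (e '' {i | (i : ℕ) < l})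

/-- The parabolic subgroup `P_l` of `K`, stabilizing the members of dimension `l - 1` and `l` of the
standard flag (and hence also their orthogonal complements). -/
def parabolic {N : ℕ} (B : LinearMap.BilinForm ℂ V) (e : Module.Basis (Fin N) ℂ V) (l : ℕ) :
    Subgroup (SO B) where
  carrier := {g | (stdFlag e (l - 1)).map (g.1 : V →ₗ[ℂ] V) = stdFlag e (l - 1) ∧
    (stdFlag e l).map (g.1 : V →ₗ[ℂ] V) = stdFlag e l}
  one_mem' := ⟨Submodule.map_id _, Submodule.map_id _⟩
  mul_mem' := by
    rintro g h ⟨hg, hg'⟩ ⟨hh, hh'⟩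
    have key : ((g * h).1 : V →ₗ[ℂ] V) = (g.1 : V →ₗ[ℂ] V) ∘ₗ (h.1 : V →ₗ[ℂ] V) := rfl
    constructor
    · rw [key, Submodule.map_comp, hh, hg]
    · rw [key, Submodule.map_comp, hh', hg']
  inv_mem' := by
    rintro g ⟨hg, hg'⟩
    have key : ((g⁻¹).1 : V →ₗ[ℂ] V) ∘ₗ (g.1 : V →ₗ[ℂ] V) = LinearMap.id := by
      ext v
      change (g.1⁻¹ * g.1) v = v
      rw [inv_mul_cancel]
      rfl
    constructor
    · conv_lhs => rw [← hg]
      rw [← Submodule.map_comp, key, Submodule.map_id]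
    · conv_lhs => rw [← hg']
      rw [← Submodule.map_comp, key, Submodule.map_id]

/-- `{x ∈ 𝔤₁ | x U = 0, x W^⊥ ⊆ T}`, where `⊥` is taken with respect to `B`. -/
def annihilating (B : LinearMap.BilinForm ℂ V) (U W T : Submodule ℂ V) :
    Submodule ℂ (Module.End ℂ V) where
  carrier := {x | x ∈ g1 B ∧ (∀ u ∈ U, x u = 0) ∧ ∀ w ∈ B.orthogonal W, x w ∈ T}
  zero_mem' := ⟨zero_mem _, fun _ _ => rfl, fun _ _ => zero_mem _⟩
  add_mem' := by
    rintro x y ⟨hx, hx1, hx2⟩ ⟨hy, hy1, hy2⟩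
    exact ⟨add_mem hx hy, fun u hu => by simp [hx1 u hu, hy1 u hu],
      fun w hw => add_mem (hx2 w hw) (hy2 w hw)⟩
  smul_mem' := by
    rintro c x ⟨hx, hx1, hx2⟩
    exact ⟨Submodule.smul_mem _ c hx, fun u hu => by simp [hx1 u hu],
      fun w hw => Submodule.smul_mem _ c (hx2 w hw)⟩

/-- `E_l = {x ∈ 𝔤₁ | x V_l = 0, x V_l^⊥ ⊆ V_{l-1}}` for the standard flag. -/
def Espace {N : ℕ} (B : LinearMap.BilinForm ℂ V) (e : Module.Basis (Fin N) ℂ V) (l : ℕ) :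
    Submodule ℂ (Module.End ℂ V) :=
  annihilating B (stdFlag e l) (stdFlag e l) (stdFlag e (l - 1))

/-- `O_l = {x ∈ 𝔤₁ | x V_l = 0, x V_{l-1}^⊥ ⊆ V_{l-1}}` for the standard flag. -/
def Ospace {N : ℕ} (B : LinearMap.BilinForm ℂ V) (e : Module.Basis (Fin N) ℂ V) (l : ℕ) :
    Submodule ℂ (Module.End ℂ V) :=
  annihilating B (stdFlag e l) (stdFlag e (l - 1)) (stdFlag e (l - 1))

/-- The orthogonal complement in `𝔤₁` with respect to the trace form `(x, y) ↦ tr (x y)`. -/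
def tracePerp (B : LinearMap.BilinForm ℂ V) (S : Submodule ℂ (Module.End ℂ V)) :
    Submodule ℂ (Module.End ℂ V) where
  carrier := {y | y ∈ g1 B ∧ ∀ x ∈ S, LinearMap.trace ℂ V (x * y) = 0}
  zero_mem' := ⟨zero_mem _, fun x _ => by simp⟩
  add_mem' := by
    rintro y z ⟨hy, hy'⟩ ⟨hz, hz'⟩
    exact ⟨add_mem hy hz, fun x hx => by simp [mul_add, hy' x hx, hz' x hx]⟩
  smul_mem' := by
    rintro c y ⟨hy, hy'⟩
    exact ⟨Submodule.smul_mem _ c hy, fun x hx => by simp [hy' x hx]⟩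

/-! ### The action of `K` by conjugation -/

theorem conj_mul (g h : V ≃ₗ[ℂ] V) (x : Module.End ℂ V) :
    (g * h).conj x = g.conj (h.conj x) := rfl

theorem conj_mem_g1 {B : LinearMap.BilinForm ℂ V} {g : V ≃ₗ[ℂ] V} (hg : g ∈ SO B)
    {x : Module.End ℂ V} (hx : x ∈ g1 B) : g.conj x ∈ g1 B := by
  obtain ⟨hx, hx'⟩ := hx
  refine ⟨by rw [LinearMap.trace_conj', hx], fun u v => ?_⟩
  have h1 : ∀ w, g.conj x w = g (x (g.symm w)) := fun w => rfl
  rw [h1, h1]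
  conv_lhs => rw [← g.apply_symm_apply v]
  conv_rhs => rw [← g.apply_symm_apply u]
  rw [hg.1, hg.1, hx']

theorem hasEigenvalue_conj {g : V ≃ₗ[ℂ] V} {x : Module.End ℂ V} {μ : ℂ}
    (h : Module.End.HasEigenvalue x μ) : Module.End.HasEigenvalue (g.conj x) μ := by
  obtain ⟨v, hv⟩ := h.exists_hasEigenvector
  refine Module.End.hasEigenvalue_of_hasEigenvector (x := g v)
    (Module.End.hasEigenvector_iff.2 ⟨Module.End.mem_eigenspace_iff.2 ?_, ?_⟩)
  · have h1 : g.conj x (g v) = g (x (g.symm (g v))) := rfl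
    rw [h1, g.symm_apply_apply, hv.apply_eq_smul, map_smul]
  · exact fun h0 => hv.2 ((map_eq_zero_iff g g.injective).1 h0)

theorem conj_mem_g1rs {B : LinearMap.BilinForm ℂ V} {g : V ≃ₗ[ℂ] V} (hg : g ∈ SO B)
    {x : Module.End ℂ V} (hx : x ∈ g1rs B) : g.conj x ∈ g1rs B := by
  refine ⟨conj_mem_g1 hg hx.1, ?_⟩
  rw [← hx.2]
  congr 1
  ext μ
  refine ⟨fun h => ?_, fun h => hasEigenvalue_conj h⟩
  have h2 := hasEigenvalue_conj (g := g⁻¹) h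
  rwa [← conj_mul, inv_mul_cancel] at h2

theorem conj_pow_apply (g : V ≃ₗ[ℂ] V) (x : Module.End ℂ V) (i : ℕ) (v : V) :
    (g.conj x ^ i) (g v) = g ((x ^ i) v) := by
  induction i with
  | zero => rfl
  | succ i ih =>
    rw [pow_succ', pow_succ', Module.End.mul_apply, ih, Module.End.mul_apply]
    exact congrArg (fun w => g (x w)) (g.symm_apply_apply _)

/-! ### The families of complete intersections of quadrics -/

/-- The total space `X_m` of the family over `𝔤₁^{rs}` of the intersections in `ℙ(V)` of the `m`
quadrics `⟨x^i v, v⟩ = 0`, `0 ≤ i < m`. -/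
def QuadricFamily (B : LinearMap.BilinForm ℂ V) (m : ℕ) :
    Set (Module.End ℂ V × Projectivization ℂ V) :=
  {p | p.1 ∈ g1rs B ∧ ∀ i < m, ∀ v ∈ p.2.submodule, B ((p.1 ^ i) v) v = 0}

namespace QuadricFamily

variable {B : LinearMap.BilinForm ℂ V} {m : ℕ}

/-- `X_m` as a subvariety of the product of the affine space `End V` and `ℙ(V)`. -/
noncomputable def variety (B : LinearMap.BilinForm ℂ V) (m : ℕ) : FunctionSpace (QuadricFamily B m) :=
  FunctionSpace.induced Subtype.val (FunctionSpace.affineProjective (Module.End ℂ V) V)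

/-- The projection to `𝔤₁^{rs}`. -/
def proj (p : QuadricFamily B m) : g1rs B := ⟨p.1.1, p.2.1⟩

/-- The action of `K`: conjugation on `𝔤₁` and the natural action on `ℙ(V)`. -/
noncomputable instance : MulAction (SO B) (QuadricFamily B m) where
  smul g p := ⟨(g.1.conj p.1.1, g.1 • p.1.2), conj_mem_g1rs g.2 p.2.1, by
    obtain ⟨⟨x, L⟩, hx, hL⟩ := p
    induction L using Projectivization.ind with
    | h v hv =>
      intro i hi w hw
      dsimp only at hw ⊢
      rw [Projectivization.smul_mk, Projectivization.submodule_mk,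
        Submodule.mem_span_singleton] at hw
      obtain ⟨c, rfl⟩ := hw
      have h1 : g.1 • v = g.1 v := rfl
      have h2 := hL i hi v (by
        rw [Projectivization.submodule_mk]; exact Submodule.mem_span_singleton_self v)
      dsimp only at h2
      rw [h1, ← map_smul, conj_pow_apply, g.2.1]
      simp [h2]⟩
  one_smul p := Subtype.ext (Prod.ext rfl (one_smul (V ≃ₗ[ℂ] V) p.1.2))
  mul_smul g h p := Subtype.ext (Prod.ext rfl (mul_smul g.1 h.1 p.1.2))

end QuadricFamily

/-! ### The families of Hessenberg varieties -/

section Hessenberg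

variable {N : ℕ} (B : LinearMap.BilinForm ℂ V) (e : Module.Basis (Fin N) ℂ V) (l : ℕ)
  (S : Submodule ℂ (Module.End ℂ V))

/-- The orbit relation of the right action `(g, y) · p = (g p, p⁻¹ y p)` of `P_l` on `K × S`. -/
def hessSetoid : Setoid (SO B × S) where
  r a b := ∃ p ∈ parabolic B e l, b.1 = a.1 * p ∧ (b.2 : Module.End ℂ V) = p.1⁻¹.conj a.2
  iseqv :=
    { refl := fun a => ⟨1, one_mem _, (mul_one _).symm, rfl⟩
      symm := by
        rintro a b ⟨p, hp, h1, h2⟩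
        refine ⟨p⁻¹, inv_mem hp, ?_, ?_⟩
        · rw [h1, mul_inv_cancel_right]
        · rw [h2, ← conj_mul]
          have : (p⁻¹).1⁻¹ * p.1⁻¹ = 1 := by simp
          rw [this]
          rfl
      trans := by
        rintro a b c ⟨p, hp, h1, h2⟩ ⟨q, hq, h3, h4⟩
        refine ⟨p * q, mul_mem hp hq, ?_, ?_⟩
        · rw [h3, h1, mul_assoc]
        · rw [h4, h2, ← conj_mul]
          congr 2 }

/-- `Hess(K/P_l, 𝔤₁, S) = K ×^{P_l} S`, for a `P_l`-stable subspace `S` of `𝔤₁`. -/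
def Hess : Type _ := Quotient (hessSetoid B e l S)

namespace Hess

variable {B e l S}

/-- The class of `(g, y)`. -/
def mk (a : SO B × S) : Hess B e l S := Quotient.mk (hessSetoid B e l S) a

/-- The map to `𝔤₁` (inside `End V`), sending the class of `(g, y)` to `g y g⁻¹`. -/
def proj : Hess B e l S → Module.End ℂ V :=
  Quotient.lift (fun a : SO B × S => a.1.1.conj a.2.1) (by
    rintro a b ⟨p, _, h1, h2⟩
    change a.1.1.conj a.2.1 = b.1.1.conj b.2.1
    rw [h1, h2, ← conj_mul]
    congr 2
    simp)

/-- The class of `(g, y)` lies over the point `g P_l` of `K / P_l`, that is, over the flag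
`g V_{l-1} ⊆ g V_l`. -/
def flag : Hess B e l S → Submodule ℂ V × Submodule ℂ V :=
  Quotient.lift (fun a : SO B × S => ((stdFlag e (l - 1)).map (a.1.1 : V →ₗ[ℂ] V),
      (stdFlag e l).map (a.1.1 : V →ₗ[ℂ] V))) (by
    rintro a b ⟨p, hp, h1, _⟩
    have key : (b.1.1 : V →ₗ[ℂ] V) = (a.1.1 : V →ₗ[ℂ] V) ∘ₗ (p.1 : V →ₗ[ℂ] V) := by
      rw [h1]; rfl
    change (_, _) = (_, _)
    rw [key, Submodule.map_comp, Submodule.map_comp, hp.1, hp.2])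

/-- The action of `K` by left multiplication on the first factor. -/
instance : MulAction (SO B) (Hess B e l S) where
  smul k := Quotient.map (fun a : SO B × S => (k * a.1, a.2)) (by
    rintro a b ⟨p, hp, h1, h2⟩
    exact ⟨p, hp, by simp only [h1, mul_assoc], h2⟩)
  one_smul := by
    rintro ⟨a⟩
    exact congrArg mk (Prod.ext (one_mul a.1) rfl)
  mul_smul := by
    rintro k k' ⟨a⟩
    exact congrArg mk (Prod.ext (mul_assoc k k' a.1) rfl)

theorem proj_smul (k : SO B) (h : Hess B e l S) : proj (k • h) = k.1.conj (proj h) := by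
  obtain ⟨a⟩ := h
  rfl

variable (B e l S)

/-- `K ×^{P_l} S` as the quotient of the closed subvariety `K × S` of the affine space
`End V × End V`. -/
noncomputable def variety : FunctionSpace (Hess B e l S) :=
  FunctionSpace.coinduced mk
    (FunctionSpace.induced
      (fun a : SO B × S => (((a.1.1 : V →ₗ[ℂ] V) : Module.End ℂ V), (a.2 : Module.End ℂ V)))
      (FunctionSpace.affine (Module.End ℂ V × Module.End ℂ V)))

end Hess

/-- The restriction of `K ×^{P_l} S → 𝔤₁` to `𝔤₁^{rs}`. -/
def HessRS : Set (Hess B e l S) := {h | h.proj ∈ g1rs B}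

namespace HessRS

/-- The (open) subvariety structure on the part over `𝔤₁^{rs}`. -/
noncomputable def variety : FunctionSpace (HessRS B e l S) :=
  FunctionSpace.induced Subtype.val (Hess.variety B e l S)

variable {B e l S}

/-- The projection to `𝔤₁^{rs}`. -/
def proj (h : HessRS B e l S) : g1rs B := ⟨h.1.proj, h.2⟩

/-- The action of `K` on the part over `𝔤₁^{rs}`. -/
instance : MulAction (SO B) (HessRS B e l S) where
  smul k h := ⟨k • h.1, by
    change Hess.proj (k • h.1) ∈ g1rs B
    rw [Hess.proj_smul]
    exact conj_mem_g1rs k.2 h.2⟩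
  one_smul h := Subtype.ext (one_smul (SO B) h.1)
  mul_smul k k' h := Subtype.ext (mul_smul k k' h.1)

end HessRS

/-- `Φ` is a `K`-equivariant isomorphism of varieties over `𝔤₁^{rs}` from `X_m` to the restriction
of `K ×^{P_l} S` to `𝔤₁^{rs}`, and it sends `(s, ⟨v⟩)` to the flag
`span {v, …, s^{l-2} v} ⊆ span {v, …, s^{l-1} v}`. -/
structure IsKrylovIsomorphism {m : ℕ} (Φ : QuadricFamily B m ≃ HessRS B e l S) : Prop where
  isIsomorphism :
    FunctionSpace.IsIsomorphism (QuadricFamily.variety B m) (HessRS.variety B e l S) Φ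
  proj_eq : ∀ p, HessRS.proj (Φ p) = QuadricFamily.proj p
  equivariant : ∀ (k : SO B) p, Φ (k • p) = k • Φ p
  flag_eq : ∀ p, ∀ v ∈ p.1.2.submodule, v ≠ 0 →
    (Φ p).1.flag =
      (Submodule.span ℂ {w | ∃ i < l - 1, w = (p.1.1 ^ i) v},
        Submodule.span ℂ {w | ∃ i < l, w = (p.1.1 ^ i) v})

end Hessenberg

end SplitPair

/-! ### Morphisms to subspaces, quotients and affine spaces -/

namespace FunctionSpace

variable {X Y Z E F G : Type*}

/-! Everything rests on one fact (`eq_bot_of_invariant_of_isotropic`): eigenvectors of a regular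
semisimple `s ∈ 𝔤₁` form an orthogonal basis, so none is isotropic, and no nonzero isotropic
subspace is `s`-invariant.

Since `⟨s^i v, s^j v⟩ = ⟨s^(i+j) v, v⟩`, the first `2k - 1` quadrics say that the span of `v, …,
s^(k-1) v` is isotropic. These vectors are independent, as a relation would produce an invariant
isotropic subspace (`pow_notMem_krylov`). The resulting flag satisfies `s K_{k-1} ⊆ K_k`, which is
the condition cutting out `O_k^⊥`; the next quadric, `⟨s^(2k-1) v, v⟩ = 0`, adds `s K_k ⊥ K_k`,
which cuts out `E_k^⊥` (`mem_tracePerp_Ospace`, `mem_tracePerp_Espace`).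

Conversely, let `y V_{k-1} ⊆ V_k` and let `ℓ` be a functional on `V_k` with kernel `V_{k-1}`. A
generator of the flag is a nonzero `v ∈ V_k` with `ℓ(y^i v) = 0` for `i < k - 1`. If `ℓ(y^(k-1) v)`
vanished too, `V_{k-1}` would contain `k` independent vectors (`eq_zero_of_forall_pow`). Hence the
`k` functionals `ℓ ∘ y^i` form a basis of the dual of `V_k`, the generator is unique up to scalar,
and a column of an adjugate matrix gives it polynomially in `y` (`krylovVec`).

For regularity, the map to the Hessenberg variety lifts locally to `K × S` by a Witt theorem with
parameters (`exists_local_isometry`), built from reflections. The inverse map is induced by the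
polynomial formula on `K × S` (`isMorphism_symm`). -/

theorem isOpen_of_forall_mem (A : FunctionSpace X) {U : Set X}
    (h : ∀ a ∈ U, ∃ W, W ⊆ U ∧ A.IsOpen W ∧ a ∈ W) : A.IsOpen U :=
  (@isOpen_iff_forall_mem_open X A.toTopologicalSpace U).2 h

theorem isOpen_set_univ (A : FunctionSpace X) : A.IsOpen Set.univ :=
  A.toTopologicalSpace.isOpen_univ

theorem regular_congr (A : FunctionSpace X) {U : Set X} (hU : A.IsOpen U) {f g : X → ℂ}
    (hf : f ∈ A.regular U) (h : Set.EqOn g f U) : g ∈ A.regular U :=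
  A.glue hU fun _ ha => ⟨U, hU, ha, subset_rfl, f, hf, h⟩

/-- The nonvanishing locus of a regular function is open, and the inverse of a nowhere vanishing
regular function is regular. -/
structure IsLocal (A : FunctionSpace X) : Prop where
  isOpen_ne_zero : ∀ U, A.IsOpen U → ∀ f ∈ A.regular U, A.IsOpen {a | a ∈ U ∧ f a ≠ 0}
  inv_mem : ∀ U, A.IsOpen U → ∀ f ∈ A.regular U, (∀ a ∈ U, f a ≠ 0) → f⁻¹ ∈ A.regular U

theorem isOpen_affine_ne_zero [AddCommGroup E] [Module ℂ E] {p : E → ℂ}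
    (hp : p ∈ polynomialFunctions E) : (affine E).IsOpen {a | p a ≠ 0} :=
  TopologicalSpace.GenerateOpen.basic _ ⟨p, hp, rfl⟩

theorem isLocal_affine (E : Type*) [AddCommGroup E] [Module ℂ E] : IsLocal (affine E) where
  isOpen_ne_zero U hU f hf := by
    refine isOpen_of_forall_mem _ fun a ⟨haU, hfa⟩ => ?_
    obtain ⟨W, hW, haW, p, hp, q, hq, h⟩ := hf a haU
    refine ⟨U ∩ W ∩ {b | p b ≠ 0}, fun b hb => ⟨hb.1.1, ?_⟩,
      (affine E).isOpen_inter _ _ ((affine E).isOpen_inter _ _ hU hW) (isOpen_affine_ne_zero hp),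
      ⟨haU, haW⟩, fun h0 => hfa ?_⟩
    · rw [(h b hb.1.1 hb.1.2).2]
      exact div_ne_zero hb.2 (h b hb.1.1 hb.1.2).1
    · rw [(h a haU haW).2, h0, zero_div]
  inv_mem U hU f hf hne := by
    intro a ha
    obtain ⟨W, hW, haW, p, hp, q, hq, h⟩ := hf a ha
    refine ⟨W, hW, haW, q, hq, p, hp, fun b hb hbW => ⟨fun h0 => hne b hb ?_, ?_⟩⟩
    · rw [(h b hb hbW).2, h0, zero_div]
    · rw [Pi.inv_apply, (h b hb hbW).2, inv_div]

theorem isOpen_induced {ι : Y → X} {A : FunctionSpace X} {U : Set X} (hU : A.IsOpen U) :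
    (induced ι A).IsOpen (ι ⁻¹' U) := ⟨U, hU, rfl⟩

theorem regular_induced {ι : Y → X} {A : FunctionSpace X} {U : Set X} (hU : A.IsOpen U)
    {f : X → ℂ} (hf : f ∈ A.regular U) : f ∘ ι ∈ (induced ι A).regular (ι ⁻¹' U) :=
  fun _ ha => ⟨U, hU, ha, f, hf, fun _ _ _ => rfl⟩

theorem IsLocal.induced {A : FunctionSpace X} (hA : IsLocal A) (ι : Y → X) :
    IsLocal (induced ι A) where
  isOpen_ne_zero U hU f hf := by
    refine isOpen_of_forall_mem _ fun a ⟨haU, hfa⟩ => ?_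
    obtain ⟨W, hW, haW, F, hF, h⟩ := hf a haU
    refine ⟨U ∩ ι ⁻¹' {b | b ∈ W ∧ F b ≠ 0}, fun b hb => ⟨hb.1, ?_⟩,
      (FunctionSpace.induced ι A).isOpen_inter _ _ hU
        (isOpen_induced (hA.isOpen_ne_zero W hW F hF)), haU, haW, ?_⟩
    · rw [h b hb.1 hb.2.1]; exact hb.2.2
    · rw [← h a haU haW]; exact hfa
  inv_mem U hU f hf hne := by
    intro a ha
    obtain ⟨W, hW, haW, F, hF, h⟩ := hf a ha
    have hW' := hA.isOpen_ne_zero W hW F hF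
    refine ⟨_, hW', ⟨haW, ?_⟩, F⁻¹, hA.inv_mem _ hW' F
      (A.restrict hW hW' (fun _ hb => hb.1) F hF) (fun _ hb => hb.2), fun b hb hbW => ?_⟩
    · rw [← h a ha haW]; exact hne a ha
    · rw [Pi.inv_apply, Pi.inv_apply, h b hb hbW.1]

theorem IsLocal.coinduced {A : FunctionSpace X} (hA : IsLocal A) (π : X → Y) :
    IsLocal (coinduced π A) where
  isOpen_ne_zero U hU f hf := hA.isOpen_ne_zero (π ⁻¹' U) hU (f ∘ π) hf
  inv_mem U hU f hf hne := hA.inv_mem (π ⁻¹' U) hU (f ∘ π) hf fun a ha => hne (π a) ha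

/-- The restriction of `φ` to the open subset `D` is a morphism. -/
structure IsMorphismOn (A : FunctionSpace X) (A' : FunctionSpace Y) (D : Set X) (φ : X → Y) :
    Prop where
  isOpen_preimage : ∀ U : Set Y, A'.IsOpen U → A.IsOpen (D ∩ φ ⁻¹' U)
  regular_comp : ∀ U : Set Y, A'.IsOpen U → ∀ f ∈ A'.regular U, f ∘ φ ∈ A.regular (D ∩ φ ⁻¹' U)

namespace IsMorphismOn

variable {A : FunctionSpace X} {C : FunctionSpace Z} {D : Set X}

theorem congr {φ ψ : X → Z} (h : IsMorphismOn A C D φ) (hψ : Set.EqOn ψ φ D) :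
    IsMorphismOn A C D ψ := by
  have key : ∀ U : Set Z, D ∩ ψ ⁻¹' U = D ∩ φ ⁻¹' U := fun U => by
    ext a
    simp only [Set.mem_inter_iff, Set.mem_preimage]
    exact and_congr_right fun ha => by rw [hψ ha]
  refine ⟨fun U hU => key U ▸ h.isOpen_preimage U hU, fun U hU f hf => ?_⟩
  rw [key]
  exact A.regular_congr (h.isOpen_preimage U hU) (h.regular_comp U hU f hf)
    fun a ha => congrArg f (hψ ha.1)

theorem toInduced {ι : Y → Z} {φ : X → Y} (h : IsMorphismOn A C D (ι ∘ φ)) :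
    IsMorphismOn A (induced ι C) D φ := by
  have hop : ∀ U : Set Y, (induced ι C).IsOpen U → A.IsOpen (D ∩ φ ⁻¹' U) := by
    rintro U ⟨O, hO, rfl⟩
    exact h.isOpen_preimage O hO
  refine ⟨hop, fun U hU f hf => A.glue (hop U hU) fun a ha => ?_⟩
  obtain ⟨W, hW, haW, F, hF, hfF⟩ := hf (φ a) ha.2
  have h1 := h.isOpen_preimage W hW
  have h2 := A.isOpen_inter _ _ (hop U hU) h1
  exact ⟨_, h2, ⟨ha, ha.1, haW⟩, Set.inter_subset_left, F ∘ ι ∘ φ,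
    A.restrict h1 h2 Set.inter_subset_right _ (h.regular_comp W hW F hF),
    fun b hb => hfF (φ b) hb.1.2 hb.2.2⟩

theorem toCoinduced {φ : X → Z} (h : IsMorphismOn A C D φ) (q : Z → Y) :
    IsMorphismOn A (coinduced q C) D (q ∘ φ) :=
  ⟨fun U hU => h.isOpen_preimage (q ⁻¹' U) hU,
    fun U hU f hf => h.regular_comp (q ⁻¹' U) hU (f ∘ q) hf⟩

theorem ofCoinduced {π : X → Y} {O : Set Y} {ψ : Y → Z}
    (h : IsMorphismOn A C (π ⁻¹' O) (ψ ∘ π)) : IsMorphismOn (coinduced π A) C O ψ :=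
  ⟨fun U hU => h.isOpen_preimage U hU, fun U hU f hf => h.regular_comp U hU f hf⟩

theorem ofInduced {φ : X → Z} (h : IsMorphismOn A C D φ) {ι : Y → X} (hι : ∀ y, ι y ∈ D) :
    IsMorphism (induced ι A) C (φ ∘ ι) := by
  have key : ∀ U : Set Z, (φ ∘ ι) ⁻¹' U = ι ⁻¹' (D ∩ φ ⁻¹' U) := fun U => by
    ext y
    exact ⟨fun hy => ⟨hι y, hy⟩, fun hy => hy.2⟩
  refine ⟨fun U hU => ?_, fun U hU f hf => ?_⟩
  · rw [key]; exact isOpen_induced (h.isOpen_preimage U hU)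
  · rw [key]; exact regular_induced (h.isOpen_preimage U hU) (h.regular_comp U hU f hf)

theorem glue {φ : X → Z} (h : ∀ x, ∃ D, x ∈ D ∧ IsMorphismOn A C D φ) : IsMorphism A C φ := by
  have hop : ∀ U : Set Z, C.IsOpen U → A.IsOpen (φ ⁻¹' U) := fun U hU =>
    A.isOpen_of_forall_mem fun a ha => by
      obtain ⟨D, haD, hD⟩ := h a
      exact ⟨_, Set.inter_subset_right, hD.isOpen_preimage U hU, haD, ha⟩
  refine ⟨hop, fun U hU f hf => A.glue (hop U hU) fun a ha => ?_⟩
  obtain ⟨D, haD, hD⟩ := h a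
  exact ⟨_, hD.isOpen_preimage U hU, ⟨haD, ha⟩, Set.inter_subset_right, f ∘ φ,
    hD.regular_comp U hU f hf, fun _ _ => rfl⟩

end IsMorphismOn

/-- The restriction to `D` of the vector-valued function `φ` has regular coordinates. -/
def RegularOn (A : FunctionSpace X) [AddCommGroup E] [Module ℂ E] (D : Set X) (φ : X → E) : Prop :=
  ∀ l : Module.Dual ℂ E, (fun x => l (φ x)) ∈ A.regular D

namespace RegularOn

variable [AddCommGroup E] [Module ℂ E] [AddCommGroup F] [Module ℂ F] [AddCommGroup G] [Module ℂ G]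
  {A : FunctionSpace X} {D : Set X} {φ ψ : X → E}

theorem restrict (h : RegularOn A D φ) {D' : Set X} (hD : A.IsOpen D) (hD' : A.IsOpen D')
    (hDD' : D' ⊆ D) : RegularOn A D' φ := fun l => A.restrict hD hD' hDD' _ (h l)

theorem const (c : E) : RegularOn A D fun _ => c := fun l =>
  (A.regular D).algebraMap_mem (l c)

theorem mem {f : X → ℂ} (hf : RegularOn A D f) : f ∈ A.regular D := hf LinearMap.id

theorem add (hφ : RegularOn A D φ) (hψ : RegularOn A D ψ) : RegularOn A D fun x => φ x + ψ x :=
  fun l => by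
    simp only [map_add]
    exact add_mem (hφ l) (hψ l)

theorem sum {ι : Type*} (s : Finset ι) {φ : ι → X → E} (h : ∀ i ∈ s, RegularOn A D (φ i)) :
    RegularOn A D fun x => ∑ i ∈ s, φ i x := fun l => by
  have : (fun x => l (∑ i ∈ s, φ i x)) = ∑ i ∈ s, fun x => l (φ i x) := by
    ext x
    simp [map_sum]
  rw [this]
  exact sum_mem fun i hi => h i hi l

theorem linear (h : RegularOn A D φ) (T : E →ₗ[ℂ] F) : RegularOn A D fun x => T (φ x) :=
  fun l => h (l ∘ₗ T)

theorem smul {f : X → ℂ} (hf : f ∈ A.regular D) (h : RegularOn A D φ) :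
    RegularOn A D fun x => f x • φ x := fun l => by
  simp only [map_smul]
  exact mul_mem hf (h l)

theorem sub (hφ : RegularOn A D φ) (hψ : RegularOn A D ψ) : RegularOn A D fun x => φ x - ψ x :=
  fun l => by
    simp only [map_sub]
    exact sub_mem (hφ l) (hψ l)

/-- Expanding the first argument in a basis gives a finite sum of regular scalars times linear
images of `ψ`, so only `E` has to be finite-dimensional. -/
theorem bilinear [FiniteDimensional ℂ E] (hφ : RegularOn A D φ) {ψ : X → F}
    (hψ : RegularOn A D ψ) (β : E →ₗ[ℂ] F →ₗ[ℂ] G) : RegularOn A D fun x => β (φ x) (ψ x) := by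
  let b := Module.finBasis ℂ E
  have : (fun x => β (φ x) (ψ x)) = fun x => ∑ i, b.coord i (φ x) • β (b i) (ψ x) := by
    ext x
    conv_lhs => rw [← b.sum_repr (φ x), map_sum, LinearMap.sum_apply]
    simp
  rw [this]
  exact sum _ fun i _ => smul (hφ (b.coord i)) (hψ.linear (β (b i)))

theorem prodMk (hφ : RegularOn A D φ) {ψ : X → F} (hψ : RegularOn A D ψ) :
    RegularOn A D fun x => (φ x, ψ x) := by
  have := (hφ.linear (LinearMap.inl ℂ E F)).add (hψ.linear (LinearMap.inr ℂ E F))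
  simpa using this

theorem polynomial_comp (h : RegularOn A D φ) {p : E → ℂ} (hp : p ∈ polynomialFunctions E) :
    p ∘ φ ∈ A.regular D := by
  induction hp using Algebra.adjoin_induction with
  | mem p hp => obtain ⟨l, rfl⟩ := hp; exact h l
  | algebraMap c => exact (A.regular D).algebraMap_mem c
  | add p q _ _ hp hq => exact add_mem hp hq
  | mul p q _ _ hp hq => exact mul_mem hp hq

/-- Polynomials in regular coordinates are regular. Locality of `A` then makes the preimages of the
generating open sets `{p ≠ 0}` open and the pulled-back quotients `p / q` regular. -/
theorem isMorphismOn (h : RegularOn A D φ) (hA : IsLocal A) (hD : A.IsOpen D) :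
    IsMorphismOn A (affine E) D φ := by
  have hop : ∀ U, (affine E).IsOpen U → A.IsOpen (D ∩ φ ⁻¹' U) := by
    intro U hU
    induction hU with
    | basic U hU =>
      obtain ⟨p, hp, rfl⟩ := hU
      exact hA.isOpen_ne_zero D hD _ (h.polynomial_comp hp)
    | univ => simpa using hD
    | inter U U' _ _ hU hU' =>
      rw [Set.preimage_inter, Set.inter_inter_distrib_left]
      exact A.isOpen_inter _ _ hU hU'
    | sUnion S _ ih =>
      refine A.isOpen_of_forall_mem ?_
      rintro a ⟨haD, U, hU, haU⟩
      exact ⟨D ∩ φ ⁻¹' U, fun b hb => ⟨hb.1, U, hU, hb.2⟩, ih U hU, haD, haU⟩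
  refine ⟨hop, fun U hU f hf => A.glue (hop U hU) fun a ha => ?_⟩
  obtain ⟨W, hW, haW, p, hp, q, hq, hpq⟩ := hf (φ a) ha.2
  have hi := hop _ ((affine E).isOpen_inter U W hU hW)
  have hs : D ∩ φ ⁻¹' (U ∩ W) ⊆ D := Set.inter_subset_left
  refine ⟨_, hi, ⟨ha.1, ha.2, haW⟩, fun b hb => ⟨hb.1, hb.2.1⟩, (p ∘ φ) * (q ∘ φ)⁻¹,
    mul_mem (A.restrict hD hi hs _ (h.polynomial_comp hp))
      (hA.inv_mem _ hi _ (A.restrict hD hi hs _ (h.polynomial_comp hq))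
        fun b hb => (hpq (φ b) hb.2.1 hb.2.2).1), fun b hb => ?_⟩
  simp only [Function.comp_apply, Pi.mul_apply, Pi.inv_apply]
  rw [(hpq (φ b) hb.2.1 hb.2.2).2, div_eq_mul_inv]

section EndValued

variable [FiniteDimensional ℂ E] {s t : X → Module.End ℂ E}

theorem mul (hs : RegularOn A D s) (ht : RegularOn A D t) : RegularOn A D fun x => s x * t x :=
  hs.bilinear ht (LinearMap.mul ℂ (Module.End ℂ E))

theorem apply (hs : RegularOn A D s) (hφ : RegularOn A D φ) : RegularOn A D fun x => s x (φ x) :=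
  hs.bilinear hφ LinearMap.id

theorem pow (hs : RegularOn A D s) (n : ℕ) : RegularOn A D fun x => s x ^ n := by
  induction n with
  | zero => simpa using RegularOn.const (A := A) (D := D) (1 : Module.End ℂ E)
  | succ n ih => simpa only [pow_succ] using ih.mul hs

end EndValued

end RegularOn

theorem regularOn_affine_id (E : Type*) [AddCommGroup E] [Module ℂ E] :
    RegularOn (affine E) Set.univ (fun x : E => x) := fun l a _ =>
  ⟨Set.univ, (affine E).isOpen_univ, Set.mem_univ a, l, Algebra.subset_adjoin ⟨l, rfl⟩, 1,
    one_mem _, fun b _ _ => by simp⟩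

theorem RegularOn.comp_induced [AddCommGroup E] [Module ℂ E]
    {A : FunctionSpace X} {D : Set X} {φ : X → E} (h : RegularOn A D φ) (hD : A.IsOpen D)
    (ι : Y → X) : RegularOn (induced ι A) (ι ⁻¹' D) (φ ∘ ι) := fun l => regular_induced hD (h l)

/-- The value at a point as a ring homomorphism on regular functions. -/
def evalHom (A : FunctionSpace X) (D : Set X) (x : X) : A.regular D →+* ℂ :=
  (Pi.evalRingHom (fun _ : X => ℂ) x).comp (A.regular D).subtype

theorem evalHom_apply (A : FunctionSpace X) (D : Set X) (x : X) (f : A.regular D) :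
    A.evalHom D x f = f.1 x := rfl

/-! ### Regular families of matrices -/

section Matrix

variable {A : FunctionSpace X} {D : Set X} {n : Type*} [Fintype n] [DecidableEq n]
  {M : X → Matrix n n ℂ}

/-- A regular family is a single matrix over the ring of regular functions. Adjugates and
characteristic polynomials can be formed over that ring, since they commute with evaluation at
points. -/
theorem exists_matrix_regular (hM : ∀ i j, (fun x => M x i j) ∈ A.regular D) :
    ∃ M' : Matrix n n (A.regular D), ∀ x, (A.evalHom D x).mapMatrix M' = M x :=
  ⟨Matrix.of fun i j => ⟨_, hM i j⟩, fun _ => rfl⟩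

theorem adjugate_regular (hM : ∀ i j, (fun x => M x i j) ∈ A.regular D) (i j : n) :
    (fun x => (M x).adjugate i j) ∈ A.regular D := by
  obtain ⟨M', h⟩ := exists_matrix_regular hM
  have : (fun x => (M x).adjugate i j) = (M'.adjugate i j).1 := by
    ext x
    rw [← h, ← RingHom.map_adjugate]
    rfl
  rw [this]
  exact (M'.adjugate i j).2

/-- The determinant of `χ'(M)` is the product of `χ'` over the eigenvalues: up to sign, the
discriminant of `χ`. It serves to show that regular semisimplicity is an open condition. -/
theorem det_aeval_derivative_charpoly_regular (hM : ∀ i j, (fun x => M x i j) ∈ A.regular D) :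
    (fun x => (Polynomial.aeval (M x) (M x).charpoly.derivative).det) ∈ A.regular D := by
  obtain ⟨M', h⟩ := exists_matrix_regular hM
  have : (fun x => (Polynomial.aeval (M x) (M x).charpoly.derivative).det) =
      (Polynomial.aeval M' M'.charpoly.derivative).det.1 := by
    ext x
    have h1 : (M x).charpoly = M'.charpoly.map (A.evalHom D x) := by
      rw [← h, ← Matrix.charpoly_map]; rfl
    rw [h1, Polynomial.derivative_map, ← h, ← evalHom_apply, RingHom.map_det]
    congr 1
    rw [Polynomial.aeval_def, Polynomial.aeval_def, Polynomial.eval₂_map, Polynomial.hom_eval₂]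
    congr 1
    ext r i j
    by_cases hij : i = j <;> simp [Matrix.algebraMap_matrix_apply, hij]
  rw [this]
  exact Subtype.property _

end Matrix

end FunctionSpace

/-! ### Isometries of a split symmetric bilinear form -/

namespace SplitPair

variable {V : Type*} [AddCommGroup V] [Module ℂ V] {N : ℕ}

/-- `e` is a basis with `⟨e_i, e_j⟩ = δ_{i+j,N+1}` (in one-based indexing). -/
def IsSplitBasis (B : LinearMap.BilinForm ℂ V) (e : Module.Basis (Fin N) ℂ V) : Prop :=
  ∀ i j : Fin N, B (e i) (e j) = if (i : ℕ) + (j : ℕ) + 1 = N then 1 else 0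

/-- `g` preserves the form `B`. -/
def IsIsometry (B : LinearMap.BilinForm ℂ V) (g : Module.End ℂ V) : Prop :=
  ∀ u v, B (g u) (g v) = B u v

theorem IsIsometry.mul {B : LinearMap.BilinForm ℂ V} {g h : Module.End ℂ V}
    (hg : IsIsometry B g) (hh : IsIsometry B h) : IsIsometry B (g * h) := fun u v =>
  (hg (h u) (h v)).trans (hh u v)

/-- The reflection along `a`. -/
noncomputable def refl (B : LinearMap.BilinForm ℂ V) (a : V) : Module.End ℂ V :=
  LinearMap.transvection (-(2 / B a a) • B a) a

theorem refl_apply (B : LinearMap.BilinForm ℂ V) (a z : V) :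
    refl B a z = z - (2 / B a a * B a z) • a := by
  simp [refl, LinearMap.transvection.apply, sub_eq_add_neg]

theorem det_refl [FiniteDimensional ℂ V] (B : LinearMap.BilinForm ℂ V) {a : V} (ha : B a a ≠ 0) :
    LinearMap.det (refl B a) = -1 := by
  rw [refl, LinearMap.transvection.det]
  simp only [LinearMap.smul_apply, smul_eq_mul]
  field_simp
  norm_num

theorem refl_apply_of_orthogonal (B : LinearMap.BilinForm ℂ V) {a z : V} (h : B a z = 0) :
    refl B a z = z := by
  simp [refl_apply, h]

/-- The matrix adjoint of `g` with respect to `B`, as a linear function of `g`. -/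
noncomputable def adj (B : LinearMap.BilinForm ℂ V) (e : Module.Basis (Fin N) ℂ V) :
    Module.End ℂ V →ₗ[ℂ] Module.End ℂ V where
  toFun g := ∑ i, (LinearMap.flip B (g (e i))).smulRight (e i.rev)
  map_add' g h := by
    ext z
    simp [add_smul, Finset.sum_add_distrib]
  map_smul' c g := by
    ext z
    simp [mul_smul, Finset.smul_sum]

variable {B : LinearMap.BilinForm ℂ V} {e : Module.Basis (Fin N) ℂ V}

namespace IsSplitBasis

theorem symm (he : IsSplitBasis B e) (u v : V) : B u v = B v u := by
  have : B = LinearMap.flip B := e.ext fun i => e.ext fun j => by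
    rw [LinearMap.flip_apply, he, he, add_comm (i : ℕ)]
  exact LinearMap.congr_fun₂ this u v

/-- The reversed basis is dual to `e` under `B`. -/
theorem expand (he : IsSplitBasis B e) (z : V) : ∑ i, B z (e i) • e i.rev = z := by
  have : ∑ i, (LinearMap.flip B (e i)).smulRight (e i.rev) = LinearMap.id := e.ext fun j => by
    simp only [LinearMap.sum_apply, LinearMap.smulRight_apply, LinearMap.flip_apply, he j,
      LinearMap.id_apply, ite_smul, one_smul, zero_smul]
    rw [Finset.sum_eq_single j.rev]
    · have := j.2
      rw [if_pos (by rw [Fin.val_rev]; omega), Fin.rev_rev]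
    · intro i _ hi
      refine if_neg fun h => hi (Fin.ext ?_)
      rw [Fin.val_rev]
      omega
    · simp
  simpa using LinearMap.congr_fun this z

theorem eq_zero (he : IsSplitBasis B e) {z : V} (h : ∀ i, B z (e i) = 0) : z = 0 := by
  rw [← he.expand z]
  simp [h]

/-- On an isometry, `adj` is the inverse. As it is linear in `g`, inverses of regular families of
isometries are regular with no division. -/
theorem adj_mul (he : IsSplitBasis B e) {g : Module.End ℂ V} (hg : IsIsometry B g) :
    adj B e g * g = 1 := by
  ext z
  rw [Module.End.mul_apply, Module.End.one_apply]
  conv_rhs => rw [← he.expand z]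
  simp [adj, hg _ _]

theorem mul_adj [FiniteDimensional ℂ V] (he : IsSplitBasis B e) {g : Module.End ℂ V}
    (hg : IsIsometry B g) : g * adj B e g = 1 := by
  have := he.adj_mul hg
  rwa [mul_eq_one_comm] at this

theorem isIsometry_refl (he : IsSplitBasis B e) {a : V} (ha : B a a ≠ 0) :
    IsIsometry B (refl B a) := fun u v => by
  simp only [refl_apply, map_sub, map_smul, LinearMap.sub_apply, LinearMap.smul_apply, smul_eq_mul,
    he.symm u a]
  field_simp
  ring

/-- The reflection along the difference of two isotropic vectors interchanges them. -/
theorem refl_sub_apply (he : IsSplitBasis B e) {a b : V} (ha : B a a = 0) (hb : B b b = 0)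
    (hab : B a b ≠ 0) : refl B (a - b) a = b := by
  have h1 : B (a - b) (a - b) = -2 * B a b := by
    simp only [map_sub, LinearMap.sub_apply, ha, hb, he.symm b a]; ring
  have h2 : B (a - b) a = - B a b := by
    simp only [map_sub, LinearMap.sub_apply, ha, he.symm b a]; ring
  rw [refl_apply, h1, h2]
  have : 2 / (-2 * B a b) * -B a b = 1 := by field_simp
  rw [this, one_smul, sub_sub_cancel]

theorem apply_sub_self (he : IsSplitBasis B e) {a b : V} (ha : B a a = 0) (hb : B b b = 0) :
    B (a - b) (a - b) = -2 * B a b := by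
  simp only [map_sub, LinearMap.sub_apply, ha, hb, he.symm b a]; ring

theorem apply_eq_zero (he : IsSplitBasis B e) {i j : Fin N} (h : (i : ℕ) + j + 1 ≠ N) :
    B (e i) (e j) = 0 := by rw [he, if_neg h]

theorem apply_eq_one (he : IsSplitBasis B e) {i j : Fin N} (h : (i : ℕ) + j + 1 = N) :
    B (e i) (e j) = 1 := by rw [he, if_pos h]

theorem exists_apply_ne_zero (he : IsSplitBasis B e) {j : ℕ} {w : V} (hw : w ∉ stdFlag e j) :
    ∃ i : Fin N, B (e i) w ≠ 0 ∧ j + i < N := by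
  by_contra! h
  refine hw ?_
  rw [← he.expand w]
  refine Submodule.sum_mem _ fun i _ => ?_
  by_cases hi : B (e i) w = 0
  · rw [he.symm w, hi, zero_smul]; exact zero_mem _
  · refine Submodule.smul_mem _ _ (Submodule.subset_span ⟨i.rev, ?_, rfl⟩)
    have := h i hi
    have := i.2
    simp only [Set.mem_ofPred_eq, Fin.val_rev]
    omega

/-- An isometry of determinant `-1` fixing `e_i` for `i < j` and moving `e_j` to a vector that is not
orthogonal to `w`. -/
theorem exists_isIsometry_det_eq_neg_one [FiniteDimensional ℂ V] (he : IsSplitBasis B e) {k : ℕ}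
    (hk : 2 * k < N) {j : Fin N} (hj : (j : ℕ) < k) {w : V} (hw : w ∉ stdFlag e j) :
    ∃ η : Module.End ℂ V, IsIsometry B η ∧ LinearMap.det η = -1 ∧
      (∀ i : Fin N, i < j → η (e i) = e i) ∧ B (η (e j)) w ≠ 0 := by
  by_cases hjw : B (e j) w = 0
  -- Here `e_j` must be moved. A vector `z` orthogonal to the earlier `e_i` is sought that pairs
  -- nontrivially with both `w` and `e_j`: the dual vector `e_{rev j}`, corrected if necessary by
  -- some `e_l` not orthogonal to `w`.
  · obtain ⟨z, hz, hzw, hzj⟩ : ∃ z, (∀ i : Fin N, i < j → B z (e i) = 0) ∧ B z w ≠ 0 ∧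
        B z (e j) ≠ 0 := by
      have h0 : ∀ i : Fin N, i < j → B (e j.rev) (e i) = 0 := fun i hi =>
        he.apply_eq_zero (by rw [Fin.val_rev]; have := Fin.lt_def.1 hi; omega)
      have h0' : B (e j.rev) (e j) = 1 := he.apply_eq_one (by rw [Fin.val_rev]; omega)
      by_cases h : B (e j.rev) w = 0
      · obtain ⟨l, hl, hjl⟩ := he.exists_apply_ne_zero hw
        have h1 : ∀ i : Fin N, i < j → B (e l) (e i) = 0 := fun i hi =>
          he.apply_eq_zero (by have := Fin.lt_def.1 hi; omega)
        have h2 : ∀ i : Fin N, i < j → B (e j.rev + e l) (e i) = 0 := fun i hi => by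
          simp [h0 i hi, h1 i hi]
        refine ⟨e j.rev + e l, h2, by simpa [h] using hl, ?_⟩
        rw [map_add, LinearMap.add_apply, h0', he]
        split_ifs <;> norm_num
      · exact ⟨_, h0, h, by rw [h0']; exact one_ne_zero⟩
    -- This `c` makes `z - c e_j` isotropic. Its pairing with `w` is unchanged because `e_j ⊥ w`, so
    -- the reflection exchanging it with `e_j` does the job.
    set c := B z z / (2 * B z (e j)) with hc
    have hjj : B (e j) (e j) = 0 := he.apply_eq_zero (by omega)
    have hxx : B (z - c • e j) (z - c • e j) = 0 := by
      simp only [map_sub, LinearMap.sub_apply, map_smul, LinearMap.smul_apply, smul_eq_mul, hjj,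
        he.symm (e j) z, hc]
      field_simp
      ring
    have hjx : B (e j) (z - c • e j) ≠ 0 := by
      simpa [hjj, he.symm (e j) z] using hzj
    have hne : B (e j - (z - c • e j)) (e j - (z - c • e j)) ≠ 0 := by
      rw [he.apply_sub_self hjj hxx]
      exact mul_ne_zero (by norm_num) hjx
    refine ⟨refl B (e j - (z - c • e j)), he.isIsometry_refl hne, det_refl B hne,
      fun i hi => refl_apply_of_orthogonal B ?_, ?_⟩
    · have : B (e j) (e i) = 0 := he.apply_eq_zero (by have := Fin.lt_def.1 hi; omega)
      simp [hz i hi, this]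
    · rw [he.refl_sub_apply hjj hxx hjx]
      simpa [hjw] using hzw
  -- Now `e_j` can stay, and only the determinant has to change. Because `2k < N`, there is an
  -- anisotropic `u` orthogonal to `V_k`; if `N = 2k + 1` the two summands coincide, and `u` is
  -- still anisotropic.
  · set u := e ⟨k, by omega⟩ + e ⟨N - 1 - k, by omega⟩ with hu
    have huu : B u u ≠ 0 := by
      have h1 : B (e ⟨k, by omega⟩) (e ⟨N - 1 - k, by omega⟩) = 1 :=
        he.apply_eq_one (by simp only; omega)
      simp only [hu, map_add, LinearMap.add_apply, h1, he.symm (e ⟨N - 1 - k, _⟩) (e ⟨k, _⟩)]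
      rw [he, he]
      split_ifs <;> norm_num
    have hfix : ∀ i : Fin N, (i : ℕ) < k → refl B u (e i) = e i := fun i hi => by
      refine refl_apply_of_orthogonal B ?_
      have h1 : B (e ⟨k, by omega⟩) (e i) = 0 := he.apply_eq_zero (by simp only; omega)
      have h2 : B (e ⟨N - 1 - k, by omega⟩) (e i) = 0 := he.apply_eq_zero (by simp only; omega)
      simp [hu, h1, h2]
    refine ⟨refl B u, he.isIsometry_refl huu, det_refl B huu,
      fun i hi => hfix i ((Fin.lt_def.1 hi).trans hj), ?_⟩
    rw [hfix j hj]
    exact hjw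

open FunctionSpace in
/-- Witt's theorem with parameters: an isotropic frame depending regularly on a parameter is, locally,
the image of the standard isotropic frame under isometries depending regularly on the parameter. -/
theorem exists_local_isometry [FiniteDimensional ℂ V] (he : IsSplitBasis B e) {X : Type*}
    {A : FunctionSpace X} (hA : A.IsLocal) {k : ℕ} (hk : 2 * k < N) {w : ℕ → X → V} {D₀ : Set X}
    (hD₀ : A.IsOpen D₀) (hw : ∀ i < k, RegularOn A D₀ (w i))
    (hiso : ∀ x ∈ D₀, ∀ i < k, ∀ j < k, B (w i x) (w j x) = 0) {x₀ : X} (hx₀ : x₀ ∈ D₀)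
    (hind : ∀ j < k, w j x₀ ∉ Submodule.span ℂ ((fun i => w i x₀) '' {i | i < j})) {j : ℕ}
    (hj : j ≤ k) :
    ∃ D, D ⊆ D₀ ∧ A.IsOpen D ∧ x₀ ∈ D ∧ ∃ g : X → Module.End ℂ V, RegularOn A D g ∧
      ∀ x ∈ D, IsIsometry B (g x) ∧ LinearMap.det (g x) = 1 ∧
        ∀ i : Fin N, (i : ℕ) < j → g x (e i) = w i x := by
  induction j with
  | zero =>
    exact ⟨D₀, subset_rfl, hD₀, hx₀, fun _ => 1, RegularOn.const _, fun x _ =>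
      ⟨fun _ _ => rfl, LinearMap.det_id, fun i hi => absurd hi (Nat.not_lt_zero _)⟩⟩
  | succ j ih =>
    obtain ⟨D, hDD₀, hD, hxD, g, hg, hg'⟩ := ih (by omega)
    let jj : Fin N := ⟨j, by omega⟩
    -- Pulling back by `g x` reduces to a frame whose first `j` vectors are already standard; only
    -- the next one, `w'`, has to be matched.
    set w' : X → V := fun x => adj B e (g x) (w j x) with hw'
    have hgw' : ∀ x ∈ D, g x (w' x) = w j x := fun x hx => by
      rw [hw', ← Module.End.mul_apply, he.mul_adj (hg' x hx).1, Module.End.one_apply]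
    have hw'D : RegularOn A D w' :=
      (hg.linear (adj B e)).apply ((hw j (by omega)).restrict hD₀ hD hDD₀)
    have hw'0 : ∀ x ∈ D, B (w' x) (w' x) = 0 := fun x hx => by
      rw [← (hg' x hx).1, hgw' x hx]
      exact hiso x (hDD₀ hx) j (by omega) j (by omega)
    have hw'e : ∀ x ∈ D, ∀ i : Fin N, i < jj → B (w' x) (e i) = 0 := fun x hx i hi => by
      have hi' : (i : ℕ) < j := hi
      rw [← (hg' x hx).1, hgw' x hx, (hg' x hx).2.2 i hi]
      exact hiso x (hDD₀ hx) j (by omega) i (by omega)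
    have hnot : w' x₀ ∉ stdFlag e jj := fun hmem => by
      refine hind j (by omega) ?_
      have h1 := Submodule.mem_map_of_mem (f := g x₀) hmem
      rw [hgw' x₀ hxD, stdFlag, Submodule.map_span] at h1
      refine Submodule.span_mono ?_ h1
      rintro _ ⟨_, ⟨i, hi, rfl⟩, rfl⟩
      exact ⟨i, hi, ((hg' x₀ hxD).2.2 i hi).symm⟩
    -- The reflection exchanging `η e_j` and `w'` needs them non-orthogonal. The constant isometry
    -- `η` secures this at `x₀`, hence on an open neighbourhood, and its determinant `-1` cancels
    -- that of the reflection.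
    obtain ⟨η, hη, hdet, hfix, hne⟩ := he.exists_isIsometry_det_eq_neg_one hk (j := jj)
      (show j < k by omega) hnot
    have hjj : B (e jj) (e jj) = 0 := he.apply_eq_zero (by simp only [jj]; omega)
    have hηη : B (η (e jj)) (η (e jj)) = 0 := by rw [hη, hjj]
    have hq : (fun x => B (η (e jj)) (w' x)) ∈ A.regular D := hw'D (B (η (e jj)))
    set D' := {x | x ∈ D ∧ B (η (e jj)) (w' x) ≠ 0} with hD'def
    have hD' : A.IsOpen D' := hA.isOpen_ne_zero D hD _ hq
    have hD'D : D' ⊆ D := fun x hx => hx.1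
    have hBne : ∀ x ∈ D', B (η (e jj) - w' x) (η (e jj) - w' x) ≠ 0 := fun x hx => by
      rw [he.apply_sub_self hηη (hw'0 x hx.1)]
      exact mul_ne_zero (by norm_num) hx.2
    refine ⟨D', hD'D.trans hDD₀, hD', ⟨hxD, hne⟩,
      fun x => g x * refl B (η (e jj) - w' x) * η, ?_, fun x hx => ?_⟩
    · have ha : RegularOn A D' fun x => η (e jj) - w' x :=
        (RegularOn.const _).sub (hw'D.restrict hD hD' hD'D)
      have hr : RegularOn A D' fun x => refl B (η (e jj) - w' x) := by
        have h1 : ∀ x ∈ D', (fun x => refl B (η (e jj) - w' x)) x =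
            (fun x => 1 - (2 * (B (η (e jj) - w' x) (η (e jj) - w' x))⁻¹) •
              (B (η (e jj) - w' x)).smulRight (η (e jj) - w' x)) x := fun x _ => by
          ext z
          simp [refl_apply, div_eq_mul_inv, mul_smul]
        intro l
        refine A.regular_congr hD' ?_ fun x hx => congrArg l (h1 x hx)
        refine (RegularOn.const _).sub (RegularOn.smul ?_ ?_) l
        · have h2 := (ha.bilinear ha B).mem
          exact mul_mem ((A.regular D').algebraMap_mem 2)
            (hA.inv_mem D' hD' _ h2 hBne)
        · exact (ha.linear B).bilinear ha (LinearMap.smulRightₗ)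
      exact ((hg.restrict hD hD' hD'D).mul hr).mul (RegularOn.const η)
    · obtain ⟨h1, h2, h3⟩ := hg' x hx.1
      refine ⟨(h1.mul (he.isIsometry_refl (hBne x hx))).mul hη, ?_, fun i hi => ?_⟩
      · rw [map_mul, map_mul, h2, hdet, det_refl B (hBne x hx)]
        norm_num
      · rw [Module.End.mul_apply, Module.End.mul_apply]
        rcases Nat.lt_succ_iff_lt_or_eq.1 hi with hi | hi
        · have hij : i < jj := hi
          have h4 : B (η (e jj) - w' x) (e i) = 0 := by
            have h5 : B (η (e jj)) (e i) = 0 := by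
              rw [← hfix i hij, hη]
              exact he.apply_eq_zero (by simp only [jj]; omega)
            rw [map_sub, LinearMap.sub_apply, h5, hw'e x hx.1 i hij, sub_zero]
          rw [hfix i hij, refl_apply_of_orthogonal B h4, h3 i hi]
        · obtain rfl : i = jj := Fin.ext hi
          rw [he.refl_sub_apply hηη (hw'0 x hx.1) hx.2, hgw' x hx.1]

end IsSplitBasis

end SplitPair

/-! ### Regular semisimple self-adjoint endomorphisms and Krylov subspaces -/

namespace SplitPair

variable {V : Type*} [AddCommGroup V] [Module ℂ V] {N : ℕ}
  {B : LinearMap.BilinForm ℂ V} {e : Module.Basis (Fin N) ℂ V}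

/-- The span of `v, s v, …, s^{l-1} v`. -/
def krylov (s : Module.End ℂ V) (v : V) (l : ℕ) : Submodule ℂ V :=
  Submodule.span ℂ {w | ∃ i < l, w = (s ^ i) v}

theorem pow_mem_krylov (s : Module.End ℂ V) (v : V) {i l : ℕ} (h : i < l) :
    (s ^ i) v ∈ krylov s v l := Submodule.subset_span ⟨i, h, rfl⟩

theorem krylov_le {s : Module.End ℂ V} {v : V} {l : ℕ} {U : Submodule ℂ V}
    (h : ∀ i < l, (s ^ i) v ∈ U) : krylov s v l ≤ U := by
  refine Submodule.span_le.2 ?_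
  rintro _ ⟨i, hi, rfl⟩
  exact h i hi

theorem apply_mem_krylov {s : Module.End ℂ V} {v u : V} {l : ℕ} (hu : u ∈ krylov s v l) :
    s u ∈ krylov s v (l + 1) := by
  suffices h : krylov s v l ≤ (krylov s v (l + 1)).comap s from h hu
  refine krylov_le fun i hi => ?_
  rw [Submodule.mem_comap, ← Module.End.mul_apply, ← pow_succ']
  exact pow_mem_krylov s v (by omega)

/-- A bilinear form that vanishes on the Krylov vectors vanishes on their span. -/
theorem apply_krylov_eq_zero {s : Module.End ℂ V} {v : V} {l : ℕ} (C : LinearMap.BilinForm ℂ V)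
    (h : ∀ i < l, ∀ j < l, C ((s ^ i) v) ((s ^ j) v) = 0) {u w : V} (hu : u ∈ krylov s v l)
    (hw : w ∈ krylov s v l) : C u w = 0 := by
  have h1 : krylov s v l ≤ LinearMap.ker (LinearMap.flip C w) := krylov_le fun i hi => by
    have h2 : krylov s v l ≤ LinearMap.ker (C ((s ^ i) v)) := krylov_le fun j hj => h i hi j hj
    exact h2 hw
  exact h1 hu

theorem apply_pow_pow {s : Module.End ℂ V} (hs : ∀ u v, B (s u) v = B u (s v)) (i j : ℕ) (u v : V) :
    B ((s ^ i) u) ((s ^ j) v) = B ((s ^ (i + j)) u) v := by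
  induction j generalizing i with
  | zero => rfl
  | succ j ih =>
    rw [pow_succ', Module.End.mul_apply, ← hs, ← Module.End.mul_apply, ← pow_succ', ih,
      show i + (j + 1) = i + 1 + j by omega]

theorem map_krylov (g : V ≃ₗ[ℂ] V) (s : Module.End ℂ V) (v : V) (l : ℕ) :
    (krylov s v l).map (g : V →ₗ[ℂ] V) = krylov (g.conj s) (g v) l := by
  rw [krylov, Submodule.map_span, krylov]
  congr 1
  ext w
  constructor
  · rintro ⟨_, ⟨i, hi, rfl⟩, rfl⟩
    exact ⟨i, hi, (conj_pow_apply g s i v).symm⟩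
  · rintro ⟨i, hi, rfl⟩
    exact ⟨_, ⟨i, hi, rfl⟩, (conj_pow_apply g s i v).symm⟩

theorem krylov_smul (s : Module.End ℂ V) (v : V) (l : ℕ) {c : ℂ} (hc : c ≠ 0) :
    krylov s (c • v) l = krylov s v l := by
  refine le_antisymm (krylov_le fun i hi => ?_) (krylov_le fun i hi => ?_)
  · rw [map_smul]
    exact Submodule.smul_mem _ c (pow_mem_krylov s v hi)
  · have := Submodule.smul_mem _ c⁻¹ (pow_mem_krylov s (c • v) hi)
    rwa [map_smul, inv_smul_smul₀ hc] at this

namespace IsSplitBasis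

theorem apply_stdFlag_eq_zero (he : IsSplitBasis B e) {k l : ℕ} (h : k + l ≤ N) {u w : V}
    (hu : u ∈ stdFlag e k) (hw : w ∈ stdFlag e l) : B u w = 0 := by
  have h1 : stdFlag e k ≤ LinearMap.ker (LinearMap.flip B w) := by
    refine Submodule.span_le.2 ?_
    rintro _ ⟨i, hi, rfl⟩
    have h2 : stdFlag e l ≤ LinearMap.ker (B (e i)) := by
      refine Submodule.span_le.2 ?_
      rintro _ ⟨j, hj, rfl⟩
      exact he.apply_eq_zero (by
        have hi' : (i : ℕ) < k := hi
        have hj' : (j : ℕ) < l := hj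
        omega)
    exact h2 hw
  exact h1 hu

theorem mem_stdFlag (he : IsSplitBasis B e) {k : ℕ} {z : V}
    (h : ∀ w ∈ B.orthogonal (stdFlag e k), B w z = 0) : z ∈ stdFlag e k := by
  by_contra hz
  obtain ⟨i, hi, hik⟩ := he.exists_apply_ne_zero hz
  refine hi (h (e i) fun u hu => ?_)
  exact he.apply_stdFlag_eq_zero (l := i + 1) (by omega) hu
    (Submodule.subset_span ⟨i, Nat.lt_succ_self _, rfl⟩)

end IsSplitBasis

theorem stdFlag_mono (e : Module.Basis (Fin N) ℂ V) {k l : ℕ} (h : k ≤ l) :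
    stdFlag e k ≤ stdFlag e l :=
  Submodule.span_mono (Set.image_mono fun _ hi => lt_of_lt_of_le hi h)

theorem finrank_stdFlag_le (e : Module.Basis (Fin N) ℂ V) (l : ℕ) :
    Module.finrank ℂ (stdFlag e l) ≤ l := by
  have := e.finiteDimensional_of_finite
  have h : stdFlag e l ≤
      Submodule.span ℂ (Set.range fun i : Fin l => if h : (i : ℕ) < N then e ⟨i, h⟩ else 0) := by
    refine Submodule.span_le.2 ?_
    rintro _ ⟨i, hi, rfl⟩
    exact Submodule.subset_span ⟨⟨i, hi⟩, by simp⟩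
  refine (Submodule.finrank_mono h).trans ((finrank_range_le_card _).trans ?_)
  simp

/-- A regular semisimple self-adjoint endomorphism has no nonzero invariant isotropic subspace. -/
theorem eq_bot_of_invariant_of_isotropic [FiniteDimensional ℂ V] (he : IsSplitBasis B e)
    {s : Module.End ℂ V} (hs : s ∈ g1rs B) {U : Submodule ℂ V} (hsU : ∀ u ∈ U, s u ∈ U)
    (hU : ∀ u ∈ U, ∀ w ∈ U, B u w = 0) : U = ⊥ := by
  by_contra hne
  have : Nontrivial U := Submodule.nontrivial_iff_ne_bot.2 hne
  obtain ⟨μ, hμ⟩ := Module.End.exists_eigenvalue (LinearMap.restrict s hsU)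
  obtain ⟨⟨u, huU⟩, hu⟩ := hμ.exists_hasEigenvector
  have hsu : s u = μ • u := congrArg Subtype.val hu.apply_eq_smul
  have hu0 : u ≠ 0 := fun h => hu.2 (Subtype.ext h)
  -- An eigenbasis is chosen that contains `u` itself. Then `u` is orthogonal to the other members
  -- by self-adjointness and to itself by isotropy, contradicting nondegeneracy.
  have hex : ∀ ν : {ν : ℂ | Module.End.HasEigenvalue s ν}, ∃ x,
      Module.End.HasEigenvector s ν x ∧ (ν.1 = μ → x = u) := by
    rintro ⟨ν, hν⟩
    by_cases h : ν = μ
    · subst h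
      exact ⟨u, Module.End.hasEigenvector_iff.2 ⟨Module.End.mem_eigenspace_iff.2 hsu, hu0⟩,
        fun _ => rfl⟩
    · obtain ⟨x, hx⟩ := Module.End.HasEigenvalue.exists_hasEigenvector hν
      exact ⟨x, hx, fun h' => absurd h' h⟩
  choose x hx hxu using hex
  have hli := Module.End.eigenvectors_linearIndependent s _ x hx
  have hV : Nontrivial V := ⟨u, 0, hu0⟩
  have hfin : {ν : ℂ | Module.End.HasEigenvalue s ν}.Finite :=
    Set.finite_of_ncard_ne_zero (by rw [hs.2]; exact Module.finrank_pos.ne')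
  have := hfin.fintype
  have hspan := hli.span_eq_top_of_card_eq_finrank'
    (by rw [← hs.2, Set.ncard_eq_toFinset_card', Set.toFinset_card])
  have hker : (⊤ : Submodule ℂ V) ≤ LinearMap.ker (B u) := by
    rw [← hspan, Submodule.span_le]
    rintro _ ⟨ν, rfl⟩
    change B u (x ν) = 0
    by_cases h : ν.1 = μ
    · rw [hxu ν h]; exact hU u huU u huU
    · have h1 := hs.1.2 u (x ν)
      rw [hsu, (hx ν).apply_eq_smul, map_smul, map_smul, LinearMap.smul_apply, smul_eq_mul,
        smul_eq_mul] at h1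
      by_contra h0
      exact h (mul_right_cancel₀ h0 h1).symm
  exact hu0 (he.eq_zero fun i => hker (Submodule.mem_top (x := e i)))

/-- If `s^j v` lay in the span of the lower powers, that span would be invariant and isotropic,
hence zero, forcing `v = 0`. -/
theorem pow_notMem_krylov [FiniteDimensional ℂ V] (he : IsSplitBasis B e)
    {s : Module.End ℂ V} (hs : s ∈ g1rs B) {v : V} (hv : v ≠ 0) {l : ℕ}
    (h : ∀ i < l, ∀ j < l, B ((s ^ i) v) ((s ^ j) v) = 0) {j : ℕ} (hj : j < l) :
    (s ^ j) v ∉ krylov s v j := fun hmem => by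
  have hbot : krylov s v j = ⊥ := by
    refine eq_bot_of_invariant_of_isotropic he hs (fun u hu => ?_) fun u hu w hw => ?_
    · have h1 : krylov s v (j + 1) ≤ krylov s v j := krylov_le fun i hi => by
        rcases Nat.lt_succ_iff_lt_or_eq.1 hi with hi | rfl
        · exact pow_mem_krylov s v hi
        · exact hmem
      exact h1 (apply_mem_krylov hu)
    · exact apply_krylov_eq_zero B (fun i hi i' hi' => h i (hi.trans hj) i' (hi'.trans hj)) hu hw
  rcases Nat.eq_zero_or_pos j with rfl | hj0
  · rw [hbot] at hmem
    exact hv hmem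
  · have := pow_mem_krylov s v hj0
    rw [hbot] at this
    exact hv this

theorem le_finrank_krylov [FiniteDimensional ℂ V] {s : Module.End ℂ V} {v : V} {l : ℕ}
    (h : ∀ j < l, (s ^ j) v ∉ krylov s v j) : l ≤ Module.finrank ℂ (krylov s v l) := by
  induction l with
  | zero => exact Nat.zero_le _
  | succ l ih =>
    refine Nat.succ_le_of_lt ((ih fun j hj => h j (by omega)).trans_lt
      (Submodule.finrank_lt_finrank_of_lt ?_))
    refine lt_of_le_not_ge (krylov_le fun i hi => pow_mem_krylov s v (by omega)) fun hle => ?_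
    exact h l (by omega) (hle (pow_mem_krylov s v (by omega)))

/-- Regular semisimplicity as the nonvanishing of a polynomial. -/
theorem ncard_eigenvalues_iff [FiniteDimensional ℂ V] (y : Module.End ℂ V) :
    {μ : ℂ | Module.End.HasEigenvalue y μ}.ncard = Module.finrank ℂ V ↔
      LinearMap.det (Polynomial.aeval y y.charpoly.derivative) ≠ 0 := by
  classical
  have hsplit : y.charpoly.Splits := IsAlgClosed.splits _
  have hne : y.charpoly ≠ 0 := y.charpoly_monic.ne_zero
  have h1 : {μ : ℂ | Module.End.HasEigenvalue y μ} = (y.charpoly.roots.toFinset : Set ℂ) := by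
    ext μ
    simp [Module.End.hasEigenvalue_iff_isRoot_charpoly, hne]
  have h2 : y.charpoly.roots.card = Module.finrank ℂ V := by
    rw [← hsplit.natDegree_eq_card_roots, y.charpoly_natDegree]
  rw [h1, Set.ncard_coe_finset, ← h2, Multiset.toFinset_card_eq_card_iff_nodup,
    Polynomial.nodup_roots_iff_of_splits hne hsplit]
  constructor
  -- Evaluating the Bézout identity `a χ + b χ' = 1` at `y` shows that `χ'(y)` is invertible.
  · rintro ⟨a, b, hab⟩ h0
    have h3 := congrArg (fun p => LinearMap.det (Polynomial.aeval y p)) hab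
    simp [h0, y.aeval_self_charpoly] at h3
  · intro h0
    by_contra hsep
    rw [← Polynomial.nodup_roots_iff_of_splits hne hsplit, Multiset.nodup_iff_count_le_one] at hsep
    push Not at hsep
    obtain ⟨μ, hμ⟩ := hsep
    -- At a multiple root `μ`, an eigenvector for `μ` is killed by `χ'(y)`.
    rw [Polynomial.count_roots, Polynomial.one_lt_rootMultiplicity_iff_isRoot hne] at hμ
    obtain ⟨v, hv⟩ := ((Module.End.hasEigenvalue_iff_isRoot_charpoly y μ).2
      hμ.1).exists_hasEigenvector
    have h3 := Module.End.aeval_apply_of_hasEigenvector (p := y.charpoly.derivative) hv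
    rw [hμ.2.eq_zero, zero_smul] at h3
    have h4 := LinearMap.ker_eq_bot'.1 ((LinearMap.isUnit_iff_ker_eq_bot _).1
      (LinearMap.isUnit_iff_isUnit_det _ |>.2 (isUnit_iff_ne_zero.2 h0)))
    exact hv.2 (h4 _ h3)

/-! ### The orthogonal complements of `E_l` and `O_l` -/

/-- The symmetric square of `V` acting on `V` through `B`. -/
noncomputable def symProd (B : LinearMap.BilinForm ℂ V) (u w : V) : Module.End ℂ V :=
  (B u).smulRight w + (B w).smulRight u

theorem symProd_apply (u w z : V) : symProd B u w z = B u z • w + B w z • u := rfl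

theorem symProd_mem_g1 [FiniteDimensional ℂ V] (he : IsSplitBasis B e) {u w : V} (h : B u w = 0) :
    symProd B u w ∈ g1 B := by
  refine ⟨?_, fun z z' => ?_⟩
  · rw [symProd, map_add, LinearMap.trace_smulRight, LinearMap.trace_smulRight, he.symm w, h,
      add_zero]
  · simp only [symProd_apply, map_add, map_smul, LinearMap.add_apply, LinearMap.smul_apply,
      smul_eq_mul, he.symm z]
    ring

/-- Testing against these operators of rank at most two turns trace-orthogonality into the vanishing
of matrix coefficients of `y`. -/
theorem trace_symProd_mul [FiniteDimensional ℂ V] (he : IsSplitBasis B e) {y : Module.End ℂ V}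
    (hy : y ∈ g1 B) (u w : V) :
    LinearMap.trace ℂ V (symProd B u w * y) = 2 * B (y u) w := by
  have h1 : symProd B u w * y = (B u ∘ₗ y).smulRight w + (B w ∘ₗ y).smulRight u := by
    ext z
    rfl
  rw [h1, map_add, LinearMap.trace_smulRight, LinearMap.trace_smulRight, LinearMap.comp_apply,
    LinearMap.comp_apply, ← hy.2, he.symm w]
  ring

theorem trace_eq_zero_of_pow_eq_zero [FiniteDimensional ℂ V] {x : Module.End ℂ V} {n : ℕ}
    (h : ∀ z, (x ^ n) z = 0) : LinearMap.trace ℂ V x = 0 :=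
  (LinearMap.isNilpotent_trace_of_isNilpotent ⟨n, LinearMap.ext h⟩).eq_zero

theorem apply_mem_orthogonal {x : Module.End ℂ V} (hx : x ∈ g1 B) {U : Submodule ℂ V}
    (h : ∀ u ∈ U, x u = 0) (z : V) : x z ∈ B.orthogonal U := fun u hu => by
  change B u (x z) = 0
  rw [← hx.2, h u hu, map_zero, LinearMap.zero_apply]

theorem Ospace_le_Espace (B : LinearMap.BilinForm ℂ V) (e : Module.Basis (Fin N) ℂ V) (k : ℕ) :
    Ospace B e k ≤ Espace B e k := fun _ hx =>
  ⟨hx.1, hx.2.1, fun w hw => hx.2.2 w fun u hu => hw u (stdFlag_mono e (Nat.sub_le k 1) hu)⟩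

section TracePerp

variable [FiniteDimensional ℂ V] {k : ℕ}

theorem symProd_mem_Ospace (he : IsSplitBasis B e) (hk : 2 * k ≤ N) {u w : V}
    (hu : u ∈ stdFlag e (k - 1)) (hw : w ∈ B.orthogonal (stdFlag e k)) :
    symProd B u w ∈ Ospace B e k := by
  have hw' : ∀ z ∈ stdFlag e k, B w z = 0 := fun z hz => by rw [he.symm]; exact hw z hz
  refine ⟨symProd_mem_g1 he (hw u (stdFlag_mono e (Nat.sub_le k 1) hu)), fun z hz => ?_,
    fun z hz => ?_⟩
  · rw [symProd_apply, he.apply_stdFlag_eq_zero (by omega) hu hz, hw' z hz]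
    simp
  · have : B u z = 0 := hz u hu
    rw [symProd_apply, this, zero_smul, zero_add]
    exact Submodule.smul_mem _ _ hu

theorem symProd_mem_Espace (he : IsSplitBasis B e) (hk : 2 * k ≤ N) {u w : V}
    (hu : u ∈ stdFlag e k) (hw : w ∈ stdFlag e k) : symProd B u w ∈ Espace B e k := by
  refine ⟨symProd_mem_g1 he (he.apply_stdFlag_eq_zero (by omega) hu hw), fun z hz => ?_,
    fun z hz => ?_⟩
  · rw [symProd_apply, he.apply_stdFlag_eq_zero (by omega) hu hz,
      he.apply_stdFlag_eq_zero (by omega) hw hz]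
    simp
  · have h1 : B u z = 0 := hz u hu
    have h2 : B w z = 0 := hz w hw
    rw [symProd_apply, h1, h2]
    simp

theorem apply_mem_stdFlag_of_mem_tracePerp (he : IsSplitBasis B e) (hk : 2 * k ≤ N)
    {y : Module.End ℂ V} (hy : y ∈ tracePerp B (Ospace B e k)) {u : V}
    (hu : u ∈ stdFlag e (k - 1)) : y u ∈ stdFlag e k := by
  refine he.mem_stdFlag fun w hw => ?_
  have h := hy.2 _ (symProd_mem_Ospace he hk hu hw)
  rw [trace_symProd_mul he hy.1] at h
  rw [he.symm]
  simpa using h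

theorem mem_tracePerp_Ospace (he : IsSplitBasis B e) (hk : 2 * k ≤ N) {y : Module.End ℂ V} :
    y ∈ tracePerp B (Ospace B e k) ↔
      y ∈ g1 B ∧ ∀ u ∈ stdFlag e (k - 1), y u ∈ stdFlag e k := by
  refine ⟨fun hy => ⟨hy.1, fun u hu => apply_mem_stdFlag_of_mem_tracePerp he hk hy hu⟩, ?_⟩
  rintro ⟨hy, h⟩
  -- `x y` is nilpotent. After the first `y`, alternating `x` and `y` runs through `V → V_k^⊥ →
  -- V_{k-1}^⊥ → V_{k-1} → V_k → 0`, which uses `x` three times.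
  refine ⟨hy, fun x hx => trace_eq_zero_of_pow_eq_zero (n := 3) fun z => ?_⟩
  have h1 : ∀ z ∈ B.orthogonal (stdFlag e k), y z ∈ B.orthogonal (stdFlag e (k - 1)) :=
    fun z hz u hu => by
      change B u (y z) = 0
      rw [← hy.2]
      exact hz _ (h u hu)
  exact hx.2.1 _ (h _ (hx.2.2 _ (h1 _ (apply_mem_orthogonal hx.1 hx.2.1 (y z)))))

theorem mem_tracePerp_Espace (he : IsSplitBasis B e) (hk : 2 * k ≤ N) {y : Module.End ℂ V} :
    y ∈ tracePerp B (Espace B e k) ↔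
      y ∈ g1 B ∧ (∀ u ∈ stdFlag e (k - 1), y u ∈ stdFlag e k) ∧
        ∀ u ∈ stdFlag e k, ∀ w ∈ stdFlag e k, B (y u) w = 0 := by
  constructor
  · refine fun hy => ⟨hy.1, fun u hu => apply_mem_stdFlag_of_mem_tracePerp he hk
      ⟨hy.1, fun x hx => hy.2 x (Ospace_le_Espace B e k hx)⟩ hu, fun u hu w hw => ?_⟩
    have h := hy.2 _ (symProd_mem_Espace he hk hu hw)
    rw [trace_symProd_mul he hy.1] at h
    simpa using h
  · rintro ⟨hy, h, h'⟩
    -- Now `x` maps `V_{k-1}^⊥` only into `V_k`, by self-adjointness. The chain becomes `V → V_k^⊥ →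
    -- V_{k-1}^⊥ → V_k → V_k^⊥ → V_{k-1} → V_k → 0`, with the extra condition on `y` giving `V_k →
    -- V_k^⊥`.
    refine ⟨hy, fun x hx => trace_eq_zero_of_pow_eq_zero (n := 4) fun z => ?_⟩
    have h1 : ∀ z ∈ B.orthogonal (stdFlag e k), y z ∈ B.orthogonal (stdFlag e (k - 1)) :=
      fun z hz u hu => by
        change B u (y z) = 0
        rw [← hy.2]
        exact hz _ (h u hu)
    have h2 : ∀ z ∈ B.orthogonal (stdFlag e (k - 1)), x z ∈ stdFlag e k := fun z hz =>
      he.mem_stdFlag fun w hw => by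
        rw [← hx.1.2]
        exact hz _ (hx.2.2 w hw)
    have h3 : ∀ z ∈ stdFlag e k, y z ∈ B.orthogonal (stdFlag e k) := fun z hz u hu => by
      change B u (y z) = 0
      rw [he.symm]
      exact h' z hz u hu
    exact hx.2.1 _ (h _ (hx.2.2 _ (h3 _ (h2 _ (h1 _
      (apply_mem_orthogonal hx.1 hx.2.1 (y z)))))))

end TracePerp

end SplitPair

/-! ### Krylov flags -/

namespace SplitPair

variable {V : Type*} [AddCommGroup V] [Module ℂ V] {N : ℕ}
  {B : LinearMap.BilinForm ℂ V} {e : Module.Basis (Fin N) ℂ V} {k m : ℕ}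

/-- The conditions cutting out `O_k^⊥` (for `m = 2 k - 1`) and `E_k^⊥` (for `m = 2 k`) in `𝔤₁`. -/
structure IsHessenberg (B : LinearMap.BilinForm ℂ V) (e : Module.Basis (Fin N) ℂ V) (k m : ℕ)
    (y : Module.End ℂ V) : Prop where
  apply_mem : ∀ u ∈ stdFlag e (k - 1), y u ∈ stdFlag e k
  apply_eq_zero : 2 * k ≤ m → ∀ u ∈ stdFlag e k, ∀ w ∈ stdFlag e k, B (y u) w = 0

/-! ### Uniqueness of the generator of a flag -/

section Generator

variable (he : IsSplitBasis B e) (hk1 : 1 ≤ k) (hk : 2 * k < N)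
include he hk1 hk

/-- In zero-based indexing `e_{N-k}` pairs nontrivially only with `e_{k-1}`, the last basis vector
of `V_k`, so it defines the functional on `V_k` with kernel `V_{k-1}`. -/
theorem mem_stdFlag_pred {u : V} (hu : u ∈ stdFlag e k)
    (h : B u (e ⟨N - k, by omega⟩) = 0) : u ∈ stdFlag e (k - 1) := by
  by_contra hu'
  obtain ⟨i, hi, hik⟩ := he.exists_apply_ne_zero hu'
  by_cases hi' : (i : ℕ) = N - k
  · have hi0 : i = ⟨N - k, by omega⟩ := Fin.ext hi'
    rw [he.symm, hi0] at hi
    exact hi h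
  · exact hi (he.apply_stdFlag_eq_zero (k := i + 1) (l := k) (by omega)
      (Submodule.subset_span ⟨i, Nat.lt_succ_self _, rfl⟩) hu)

theorem apply_stdFlag_pred {u : V} (hu : u ∈ stdFlag e (k - 1)) :
    B u (e ⟨N - k, by omega⟩) = 0 :=
  he.apply_stdFlag_eq_zero (k := k - 1) (l := N - k + 1) (by omega) hu
    (Submodule.subset_span ⟨⟨N - k, by omega⟩, Nat.lt_succ_self _, rfl⟩)

theorem pow_mem_stdFlag {y : Module.End ℂ V} (hy : ∀ u ∈ stdFlag e (k - 1), y u ∈ stdFlag e k)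
    {v : V} (hv : v ∈ stdFlag e k) {j : ℕ}
    (h : ∀ i < j, B ((y ^ i) v) (e ⟨N - k, by omega⟩) = 0) :
    (y ^ j) v ∈ stdFlag e k ∧ ∀ i < j, (y ^ i) v ∈ stdFlag e (k - 1) := by
  induction j with
  | zero => exact ⟨hv, fun i hi => absurd hi (Nat.not_lt_zero i)⟩
  | succ j ih =>
    obtain ⟨h1, h2⟩ := ih fun i hi => h i (by omega)
    have h3 := mem_stdFlag_pred he hk1 hk h1 (h j (Nat.lt_succ_self j))
    refine ⟨?_, fun i hi => ?_⟩
    · rw [pow_succ']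
      exact hy _ h3
    · rcases Nat.lt_succ_iff_lt_or_eq.1 hi with hi | rfl
      · exact h2 i hi
      · exact h3

variable [FiniteDimensional ℂ V]

/-- Otherwise `v, …, y^(k-1) v` would be `k` independent vectors in `V_{k-1}`, whose dimension is at
most `k - 1`. -/
theorem eq_zero_of_forall_pow {y : Module.End ℂ V} (hrs : y ∈ g1rs B)
    (hy : ∀ u ∈ stdFlag e (k - 1), y u ∈ stdFlag e k) {v : V} (hv : v ∈ stdFlag e k)
    (h : ∀ i < k, B ((y ^ i) v) (e ⟨N - k, by omega⟩) = 0) : v = 0 := by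
  by_contra hv0
  have h1 := (pow_mem_stdFlag he hk1 hk hy hv h).2
  have h2 := le_finrank_krylov fun j hj => pow_notMem_krylov he hrs hv0
    (fun i hi j hj => he.apply_stdFlag_eq_zero (by omega) (h1 i hi) (h1 j hj)) hj
  have h3 := Submodule.finrank_mono (krylov_le h1)
  have h4 := finrank_stdFlag_le e (k - 1)
  omega

theorem krylov_eq_stdFlag {y : Module.End ℂ V} (hrs : y ∈ g1rs B)
    (hy : ∀ u ∈ stdFlag e (k - 1), y u ∈ stdFlag e k) {v : V} (hv : v ∈ stdFlag e k)
    (hv0 : v ≠ 0) (h : ∀ i < k - 1, B ((y ^ i) v) (e ⟨N - k, by omega⟩) = 0) :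
    krylov y v (k - 1) = stdFlag e (k - 1) ∧ krylov y v k = stdFlag e k := by
  obtain ⟨h1, h2⟩ := pow_mem_stdFlag he hk1 hk hy hv h
  have h3 : ∀ i < k, (y ^ i) v ∈ stdFlag e k := fun i hi => by
    rcases Nat.lt_or_ge i (k - 1) with hi' | hi'
    · exact stdFlag_mono e (Nat.sub_le k 1) (h2 i hi')
    · obtain rfl : i = k - 1 := by omega
      exact h1
  have h4 : ∀ j < k, (y ^ j) v ∉ krylov y v j := fun j hj => pow_notMem_krylov he hrs hv0
    (fun i hi j hj => he.apply_stdFlag_eq_zero (by omega) (h3 i hi) (h3 j hj)) hj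
  exact ⟨Submodule.eq_of_le_of_finrank_le (krylov_le h2)
      ((finrank_stdFlag_le e _).trans (le_finrank_krylov fun j hj => h4 j (by omega))),
    Submodule.eq_of_le_of_finrank_le (krylov_le h3)
      ((finrank_stdFlag_le e _).trans (le_finrank_krylov h4))⟩

/-- For both vectors only the last functional can be nonzero, and the combination `α v' - α' v`
kills that one too, so it vanishes. -/
theorem exists_smul_eq_of_krylov_eq {y : Module.End ℂ V} (hrs : y ∈ g1rs B)
    (hy : ∀ u ∈ stdFlag e (k - 1), y u ∈ stdFlag e k) {v v' : V}
    (hv0 : v ≠ 0) (hv : krylov y v (k - 1) = stdFlag e (k - 1)) (hv1 : krylov y v k = stdFlag e k)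
    (hv' : krylov y v' (k - 1) = stdFlag e (k - 1)) (hv1' : krylov y v' k = stdFlag e k) :
    ∃ c : ℂ, v' = c • v := by
  have hm : v ∈ stdFlag e k := hv1 ▸ pow_mem_krylov y v (i := 0) (by omega)
  have hm' : v' ∈ stdFlag e k := hv1' ▸ pow_mem_krylov y v' (i := 0) (by omega)
  have h0 : ∀ i < k - 1, B ((y ^ i) v) (e ⟨N - k, by omega⟩) = 0 := fun i hi =>
    apply_stdFlag_pred he hk1 hk (hv ▸ pow_mem_krylov y v hi)
  have h0' : ∀ i < k - 1, B ((y ^ i) v') (e ⟨N - k, by omega⟩) = 0 := fun i hi =>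
    apply_stdFlag_pred he hk1 hk (hv' ▸ pow_mem_krylov y v' hi)
  set α := B ((y ^ (k - 1)) v) (e ⟨N - k, by omega⟩) with hα
  set α' := B ((y ^ (k - 1)) v') (e ⟨N - k, by omega⟩) with hα'
  have hne : α ≠ 0 := fun hz => hv0 <| eq_zero_of_forall_pow he hk1 hk hrs hy hm fun i hi => by
    rcases Nat.lt_or_ge i (k - 1) with hi' | hi'
    · exact h0 i hi'
    · obtain rfl : i = k - 1 := by omega
      exact hz
  have hz : α • v' - α' • v = 0 := by
    refine eq_zero_of_forall_pow he hk1 hk hrs hy (sub_mem (Submodule.smul_mem _ _ hm')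
      (Submodule.smul_mem _ _ hm)) fun i hi => ?_
    rcases Nat.lt_or_ge i (k - 1) with hi' | hi'
    · simp [h0 i hi', h0' i hi']
    · obtain rfl : i = k - 1 := by omega
      simp only [map_sub, map_smul, LinearMap.sub_apply, LinearMap.smul_apply, smul_eq_mul]
      rw [← hα, ← hα']
      ring
  refine ⟨α⁻¹ * α', ?_⟩
  rw [mul_smul, ← sub_eq_zero.1 hz, inv_smul_smul₀ hne]

end Generator

/-- The matrix of the functionals `⟨y^i ·, e_{N+1-k}⟩` on the isotropic subspace `V_k`. -/
noncomputable def krylovMatrix (B : LinearMap.BilinForm ℂ V) (e : Module.Basis (Fin N) ℂ V)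
    (hk1 : 1 ≤ k) (hk : 2 * k < N) (y : Module.End ℂ V) : Matrix (Fin k) (Fin k) ℂ :=
  Matrix.of fun i j => B ((y ^ (i : ℕ)) (e ⟨j, by omega⟩)) (e ⟨N - k, by omega⟩)

/-- The generator of the Krylov flag attached to `y` and the standard flag. -/
noncomputable def krylovVec (B : LinearMap.BilinForm ℂ V) (e : Module.Basis (Fin N) ℂ V)
    (hk1 : 1 ≤ k) (hk : 2 * k < N) (y : Module.End ℂ V) : V :=
  ∑ j : Fin k, (krylovMatrix B e hk1 hk y).adjugate j ⟨k - 1, by omega⟩ • e ⟨j, by omega⟩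

theorem sum_smul_mem_stdFlag (e : Module.Basis (Fin N) ℂ V) (hk : 2 * k < N) (c : Fin k → ℂ) :
    ∑ j : Fin k, c j • e ⟨j, by omega⟩ ∈ stdFlag e k :=
  Submodule.sum_mem _ fun j _ => Submodule.smul_mem _ _ (Submodule.subset_span ⟨_, j.2, rfl⟩)

/-! ### The polynomial formula for the generator -/

section KrylovVec

variable (he : IsSplitBasis B e) (hk1 : 1 ≤ k) (hk : 2 * k < N)

theorem apply_pow_sum_smul (y : Module.End ℂ V) (c : Fin k → ℂ) (i : Fin k) :
    B ((y ^ (i : ℕ)) (∑ j : Fin k, c j • e ⟨j, by omega⟩)) (e ⟨N - k, by omega⟩) =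
      (krylovMatrix B e hk1 hk y).mulVec c i := by
  simp [krylovMatrix, Matrix.mulVec, dotProduct, map_sum, LinearMap.sum_apply, mul_comm]

/-- This is the last column of `M * adj M = det M • 1`; choosing that column makes all functionals
but the last vanish. -/
theorem apply_pow_krylovVec (y : Module.End ℂ V) (i : Fin k) :
    B ((y ^ (i : ℕ)) (krylovVec B e hk1 hk y)) (e ⟨N - k, by omega⟩) =
      if (i : ℕ) = k - 1 then (krylovMatrix B e hk1 hk y).det else 0 := by
  rw [krylovVec, apply_pow_sum_smul hk1 hk]
  have h := congrFun (congrFun (Matrix.mul_adjugate (krylovMatrix B e hk1 hk y)) i) ⟨k - 1, by omega⟩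
  rw [Matrix.mul_apply] at h
  refine h.trans ?_
  simp [Matrix.one_apply, Fin.ext_iff]

variable [FiniteDimensional ℂ V]
include he

/-- A kernel vector gives the coordinates of a vector of `V_k` killed by all `k` functionals. -/
theorem det_krylovMatrix_ne_zero {y : Module.End ℂ V} (hrs : y ∈ g1rs B)
    (hy : ∀ u ∈ stdFlag e (k - 1), y u ∈ stdFlag e k) : (krylovMatrix B e hk1 hk y).det ≠ 0 := by
  intro h0
  obtain ⟨c, hc, hc0⟩ := Matrix.exists_mulVec_eq_zero_iff.2 h0
  have h1 := eq_zero_of_forall_pow he hk1 hk hrs hy (sum_smul_mem_stdFlag e hk c) fun i hi => by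
    have := apply_pow_sum_smul (B := B) (e := e) hk1 hk y c ⟨i, hi⟩
    rwa [hc0] at this
  have hli : LinearIndependent ℂ fun j : Fin k => e ⟨j, by omega⟩ :=
    e.linearIndependent.comp (fun j : Fin k => (⟨j, by omega⟩ : Fin N))
      fun i j h => Fin.ext (Fin.mk.inj h)
  exact hc (funext (Fintype.linearIndependent_iff.1 hli c h1))

theorem krylovVec_spec {y : Module.End ℂ V} (hrs : y ∈ g1rs B)
    (hy : ∀ u ∈ stdFlag e (k - 1), y u ∈ stdFlag e k) :
    krylovVec B e hk1 hk y ≠ 0 ∧ krylov y (krylovVec B e hk1 hk y) (k - 1) = stdFlag e (k - 1) ∧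
      krylov y (krylovVec B e hk1 hk y) k = stdFlag e k := by
  have h0 : krylovVec B e hk1 hk y ≠ 0 := fun h => by
    have h1 := apply_pow_krylovVec (B := B) (e := e) hk1 hk y ⟨k - 1, by omega⟩
    rw [h, if_pos rfl, map_zero, map_zero, LinearMap.zero_apply] at h1
    exact det_krylovMatrix_ne_zero he hk1 hk hrs hy h1.symm
  refine ⟨h0, krylov_eq_stdFlag he hk1 hk hrs hy (sum_smul_mem_stdFlag e hk _) h0 fun i hi => ?_⟩
  have h1 := apply_pow_krylovVec (B := B) (e := e) hk1 hk y ⟨i, by omega⟩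
  rwa [if_neg (by simp only; omega)] at h1

end KrylovVec

/-- A vector generating the standard flag lies on the quadrics. -/
theorem apply_pow_eq_zero_of_krylov_eq (he : IsSplitBasis B e) (hk1 : 1 ≤ k) (hk : 2 * k < N)
    (hm : m ≤ 2 * k) {y : Module.End ℂ V} (hy : y ∈ g1 B) (hyH : IsHessenberg B e k m y) {v : V}
    (hv : krylov y v k = stdFlag e k) {i : ℕ} (hi : i < m) : B ((y ^ i) v) v = 0 := by
  have hmem : ∀ i < k, (y ^ i) v ∈ stdFlag e k := fun i hi => hv ▸ pow_mem_krylov y v hi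
  rcases Nat.lt_or_ge i (2 * k - 1) with h | h
  -- For `i ≤ 2k - 2` both halves are at most `k - 1`, and isotropy of `V_k` suffices. The remaining
  -- exponent `2k - 1` occurs only for `m = 2k`, where the extra Hessenberg condition applies.
  · rw [show i = i / 2 + (i - i / 2) by omega, ← apply_pow_pow hy.2]
    exact he.apply_stdFlag_eq_zero (by omega) (hmem _ (by omega)) (hmem _ (by omega))
  · rw [show i = (k - 1 + 1) + (k - 1) by omega, ← apply_pow_pow hy.2, pow_succ',
      Module.End.mul_apply]
    exact hyH.apply_eq_zero (by omega) _ (hmem _ (by omega)) _ (hmem _ (by omega))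

/-- An isometry carrying the standard flag to the Krylov flag of a point of the quadrics carries the
Hessenberg conditions to `s`. -/
theorem isHessenberg_of_map_stdFlag {s : Module.End ℂ V} (hs : s ∈ g1 B) {v : V}
    (hv : ∀ i < m, B ((s ^ i) v) v = 0)
    (hk1 : 1 ≤ k) {g : V ≃ₗ[ℂ] V} (hg : g ∈ SO B)
    (h1 : (stdFlag e (k - 1)).map (g : V →ₗ[ℂ] V) = krylov s v (k - 1))
    (h2 : (stdFlag e k).map (g : V →ₗ[ℂ] V) = krylov s v k) :
    IsHessenberg B e k m (g⁻¹.conj s) := by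
  have hconj : ∀ u, g (g⁻¹.conj s u) = s (g u) := fun u => g.apply_symm_apply _
  constructor
  · intro u hu
    have h3 : g u ∈ krylov s v (k - 1) := h1 ▸ Submodule.mem_map_of_mem hu
    have h4 := apply_mem_krylov h3
    rw [Nat.sub_add_cancel hk1, ← h2, ← hconj] at h4
    obtain ⟨w, hw, hwu⟩ := h4
    rwa [← g.injective hwu]
  · intro hkm u hu w hw
    rw [← hg.1, hconj]
    -- On Krylov vectors this form takes the values `⟨s^(i+j+1) v, v⟩` with `i + j + 1 ≤ 2k - 1 <
    -- m`.
    refine apply_krylov_eq_zero (B ∘ₗ s) (fun i hi j hj => ?_)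
      (h2 ▸ Submodule.mem_map_of_mem hu : g u ∈ krylov s v k)
      (h2 ▸ Submodule.mem_map_of_mem hw : g w ∈ krylov s v k)
    rw [LinearMap.comp_apply, ← Module.End.mul_apply, ← pow_succ', apply_pow_pow hs.2]
    exact hv _ (by omega)

end SplitPair

/-! ### The correspondence between quadrics and Hessenberg varieties -/

namespace SplitPair

variable {V : Type*} [AddCommGroup V] [Module ℂ V] {N : ℕ}
  {B : LinearMap.BilinForm ℂ V} {e : Module.Basis (Fin N) ℂ V} {k m : ℕ}
  {S : Submodule ℂ (Module.End ℂ V)}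

theorem projectivization_eq_mk {L : Projectivization ℂ V} {v : V} (hv : v ∈ L.submodule)
    (hv0 : v ≠ 0) : L = Projectivization.mk ℂ v hv0 := by
  induction L using Projectivization.ind with
  | h w hw =>
    rw [Projectivization.submodule_mk] at hv
    obtain ⟨c, rfl⟩ := Submodule.mem_span_singleton.1 hv
    have hc : c ≠ 0 := fun h => hv0 (by rw [h, zero_smul])
    refine (Projectivization.mk_eq_mk_iff' ℂ _ _ _ _).2 ⟨c⁻¹, ?_⟩
    rw [inv_smul_smul₀ hc]

theorem mem_submodule_mk {v : V} (hv : v ≠ 0) : v ∈ (Projectivization.mk ℂ v hv).submodule := by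
  rw [Projectivization.submodule_mk]
  exact Submodule.mem_span_singleton_self v

theorem rep_mem_submodule (L : Projectivization ℂ V) : L.rep ∈ L.submodule := by
  rw [Projectivization.submodule_eq]
  exact Submodule.mem_span_singleton_self _

theorem mk_mem_quadricFamily {s : Module.End ℂ V} (hs : s ∈ g1rs B) {v : V} (hv0 : v ≠ 0)
    (hv : ∀ i < m, B ((s ^ i) v) v = 0) :
    (s, Projectivization.mk ℂ v hv0) ∈ QuadricFamily B m := by
  refine ⟨hs, fun i hi w hw => ?_⟩
  rw [Projectivization.submodule_mk] at hw
  obtain ⟨c, rfl⟩ := Submodule.mem_span_singleton.1 hw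
  simp [hv i hi]

/-- `h` is the point over `s` whose flag is the Krylov flag of `v`, where `p = (s, ⟨v⟩)`. -/
def IsKrylovPoint (p : QuadricFamily B m) (h : Hess B e k S) : Prop :=
  h.proj = p.1.1 ∧ ∀ v ∈ p.1.2.submodule, v ≠ 0 →
    h.flag = (krylov p.1.1 v (k - 1), krylov p.1.1 v k)

theorem isKrylovPoint_of_mem {p : QuadricFamily B m} {h : Hess B e k S} {v : V}
    (hv : v ∈ p.1.2.submodule) (hv0 : v ≠ 0) (h1 : h.proj = p.1.1)
    (h2 : h.flag = (krylov p.1.1 v (k - 1), krylov p.1.1 v k)) : IsKrylovPoint p h := by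
  refine ⟨h1, fun w hw hw0 => ?_⟩
  rw [projectivization_eq_mk hv hv0, Projectivization.submodule_mk] at hw
  obtain ⟨c, rfl⟩ := Submodule.mem_span_singleton.1 hw
  have hc : c ≠ 0 := fun h => hw0 (by rw [h, zero_smul])
  rw [krylov_smul _ _ _ hc, krylov_smul _ _ _ hc, h2]

theorem Hess.flag_smul (κ : SO B) (h : Hess B e k S) :
    (κ • h).flag = (h.flag.1.map (κ.1 : V →ₗ[ℂ] V), h.flag.2.map (κ.1 : V →ₗ[ℂ] V)) := by
  obtain ⟨a⟩ := h
  exact Prod.ext (Submodule.map_comp (a.1.1 : V →ₗ[ℂ] V) (κ.1 : V →ₗ[ℂ] V) _)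
    (Submodule.map_comp (a.1.1 : V →ₗ[ℂ] V) (κ.1 : V →ₗ[ℂ] V) _)

theorem IsKrylovPoint.smul {p : QuadricFamily B m} {h : Hess B e k S} (hp : IsKrylovPoint p h)
    (κ : SO B) : IsKrylovPoint (κ • p) (κ • h) := by
  have hv := rep_mem_submodule p.1.2
  have hv0 := p.1.2.rep_nonzero
  have hκv0 : κ.1 p.1.2.rep ≠ 0 := fun h0 => hv0 ((map_eq_zero_iff κ.1 κ.1.injective).1 h0)
  refine isKrylovPoint_of_mem (v := κ.1 p.1.2.rep) ?_ hκv0 ?_ ?_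
  · have h1 : (κ • p).1.2 = Projectivization.mk ℂ (κ.1 p.1.2.rep) hκv0 := by
      change κ.1 • p.1.2 = _
      conv_lhs => rw [← p.1.2.mk_rep]
      exact Projectivization.smul_mk _ _
    rw [h1]
    exact mem_submodule_mk hκv0
  · rw [Hess.proj_smul, hp.1]
    rfl
  · rw [Hess.flag_smul, hp.2 _ hv hv0]
    exact Prod.ext (map_krylov _ _ _ _) (map_krylov _ _ _ _)

theorem conj_inv_conj (g : V ≃ₗ[ℂ] V) (x : Module.End ℂ V) : g⁻¹.conj (g.conj x) = x := by
  rw [← conj_mul, inv_mul_cancel]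
  rfl

theorem conj_conj_inv (g : V ≃ₗ[ℂ] V) (x : Module.End ℂ V) : g.conj (g⁻¹.conj x) = x := by
  rw [← conj_mul, mul_inv_cancel]
  rfl

/-- A point of the Hessenberg variety is determined by its image in `𝔤₁` and its flag. -/
theorem Hess.eq_of_proj_eq_of_flag_eq {h h' : Hess B e k S} (h1 : h.proj = h'.proj)
    (h2 : h.flag = h'.flag) : h = h' := by
  obtain ⟨⟨g, y⟩⟩ := h
  obtain ⟨⟨g', y'⟩⟩ := h'
  change g.1.conj y.1 = g'.1.conj y'.1 at h1
  change (_, _) = (_, _) at h2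
  obtain ⟨h3, h4⟩ := Prod.ext_iff.1 h2
  have key : ∀ U : Submodule ℂ V,
      U.map (g.1 : V →ₗ[ℂ] V) = U.map (g'.1 : V →ₗ[ℂ] V) →
        U.map ((g⁻¹ * g').1 : V →ₗ[ℂ] V) = U := fun U hU => by
    have h5 : ((g⁻¹ * g').1 : V →ₗ[ℂ] V) =
        ((g⁻¹).1 : V →ₗ[ℂ] V) ∘ₗ (g'.1 : V →ₗ[ℂ] V) := rfl
    have h6 : ((g⁻¹).1 : V →ₗ[ℂ] V) ∘ₗ (g.1 : V →ₗ[ℂ] V) = LinearMap.id :=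
      LinearMap.ext fun v => g.1.symm_apply_apply v
    rw [h5, Submodule.map_comp, ← hU, ← Submodule.map_comp, h6, Submodule.map_id]
  refine Quotient.sound ⟨g⁻¹ * g', ⟨key _ h3, key _ h4⟩, ?_, ?_⟩
  · simp
  · change y'.1 = (g⁻¹ * g').1⁻¹.conj y.1
    have h7 : (g⁻¹ * g').1⁻¹ = g'.1⁻¹ * g.1 := by simp
    rw [h7, conj_mul, h1, conj_inv_conj]

theorem IsKrylovPoint.right_unique {p : QuadricFamily B m} {h h' : Hess B e k S}
    (hp : IsKrylovPoint p h) (hp' : IsKrylovPoint p h') : h = h' := by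
  have hv := rep_mem_submodule p.1.2
  have hv0 := p.1.2.rep_nonzero
  exact Hess.eq_of_proj_eq_of_flag_eq (hp.1.trans hp'.1.symm)
    ((hp.2 _ hv hv0).trans (hp'.2 _ hv hv0).symm)

theorem krylov_symm_eq {g : V ≃ₗ[ℂ] V} {y : Module.End ℂ V} {v : V} {l : ℕ} {U : Submodule ℂ V}
    (h : U.map (g : V →ₗ[ℂ] V) = krylov (g.conj y) v l) : krylov y (g.symm v) l = U := by
  have h1 := map_krylov g y (g.symm v) l
  rw [g.apply_symm_apply, ← h] at h1
  exact Submodule.map_injective_of_injective g.injective h1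

/-- Every point of `K × S` with regular semisimple second component lies over a point of the family
of quadrics, given by the Krylov vector. -/
theorem isKrylovPoint_krylovVec [FiniteDimensional ℂ V] (he : IsSplitBasis B e) (hk1 : 1 ≤ k)
    (hk : 2 * k < N) (a : SO B × S) (hrs : a.2.1 ∈ g1rs B)
    (hH : IsHessenberg B e k m a.2.1) (p : QuadricFamily B m) (hp : p.1.1 = a.1.1.conj a.2.1)
    (hp' : a.1.1 (krylovVec B e hk1 hk a.2.1) ∈ p.1.2.submodule) :
    IsKrylovPoint p (Hess.mk a : Hess B e k S) := by
  obtain ⟨h0, h1, h2⟩ := krylovVec_spec he hk1 hk hrs hH.apply_mem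
  refine isKrylovPoint_of_mem hp'
    (fun h => h0 ((map_eq_zero_iff a.1.1 a.1.1.injective).1 h)) hp.symm ?_
  rw [hp, ← map_krylov, ← map_krylov, h1, h2]
  rfl

theorem apply_pow_krylovVec_conj [FiniteDimensional ℂ V] (he : IsSplitBasis B e) (hk1 : 1 ≤ k)
    (hk : 2 * k < N) (hm : m ≤ 2 * k) (a : SO B × S) (hrs : a.2.1 ∈ g1rs B)
    (hH : IsHessenberg B e k m a.2.1) :
    ∃ h0 : a.1.1 (krylovVec B e hk1 hk a.2.1) ≠ 0,
      (a.1.1.conj a.2.1, Projectivization.mk ℂ _ h0) ∈ QuadricFamily B m := by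
  obtain ⟨h0, h1, h2⟩ := krylovVec_spec he hk1 hk hrs hH.apply_mem
  refine ⟨fun h => h0 ((map_eq_zero_iff a.1.1 a.1.1.injective).1 h),
    mk_mem_quadricFamily (conj_mem_g1rs a.1.2 hrs) _ fun i hi => ?_⟩
  rw [conj_pow_apply, a.1.2.1]
  exact apply_pow_eq_zero_of_krylov_eq he hk1 hk hm hrs.1 hH h2 hi

/-- Translating by `g⁻¹` turns both lines into generators of the standard flag for the same `y`,
where the generator is unique up to scalar. -/
theorem IsKrylovPoint.left_unique [FiniteDimensional ℂ V] (he : IsSplitBasis B e) (hk1 : 1 ≤ k)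
    (hk : 2 * k < N) (hS : ∀ y ∈ S, IsHessenberg B e k m y) {p p' : QuadricFamily B m}
    {h : Hess B e k S} (hp : IsKrylovPoint p h) (hp' : IsKrylovPoint p' h) : p = p' := by
  obtain ⟨⟨g, y⟩⟩ := h
  have hs : g.1.conj y.1 = p.1.1 := hp.1
  have hs' : g.1.conj y.1 = p'.1.1 := hp'.1
  have hrs : y.1 ∈ g1rs B := by
    have h1 := conj_mem_g1rs (g⁻¹).2 p.2.1
    rw [← hs] at h1
    rwa [← conj_inv_conj g.1 y.1]
  have hv0 := p.1.2.rep_nonzero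
  have hv0' := p'.1.2.rep_nonzero
  have hf := Prod.ext_iff.1 (hp.2 _ (rep_mem_submodule _) hv0)
  have hf' := Prod.ext_iff.1 (hp'.2 _ (rep_mem_submodule _) hv0')
  rw [← hs] at hf
  rw [← hs'] at hf'
  obtain ⟨c, hc⟩ := exists_smul_eq_of_krylov_eq he hk1 hk hrs (hS _ y.2).apply_mem
    (v := g.1.symm p.1.2.rep) (v' := g.1.symm p'.1.2.rep)
    (fun h => hv0 ((map_eq_zero_iff g.1.symm g.1.symm.injective).1 h))
    (krylov_symm_eq hf.1) (krylov_symm_eq hf.2) (krylov_symm_eq hf'.1) (krylov_symm_eq hf'.2)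
  rw [← map_smul] at hc
  refine Subtype.ext (Prod.ext (hs.symm.trans hs') ?_)
  have h1 : p'.1.2.rep ∈ p.1.2.submodule := by
    rw [g.1.symm.injective hc]
    exact Submodule.smul_mem _ c (rep_mem_submodule _)
  rw [projectivization_eq_mk h1 hv0', p'.1.2.mk_rep]

/-- An element of `K` taking the standard isotropic frame to the Krylov frame produces the point of
the Hessenberg variety over a point of the family of quadrics. -/
theorem exists_isKrylovPoint_of_isIsometry [FiniteDimensional ℂ V] (he : IsSplitBasis B e)
    (hk1 : 1 ≤ k) (hk : 2 * k < N) (hS : ∀ y ∈ g1 B, IsHessenberg B e k m y → y ∈ S)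
    (p : QuadricFamily B m) {v : V} (hv : v ∈ p.1.2.submodule) (hv0 : v ≠ 0) {g : Module.End ℂ V}
    (hg : IsIsometry B g) (hdet : LinearMap.det g = 1)
    (hgv : ∀ i : Fin N, (i : ℕ) < k → g (e i) = (p.1.1 ^ (i : ℕ)) v) :
    ∃ a : SO B × S, ((a.1.1 : V →ₗ[ℂ] V) : Module.End ℂ V) = g ∧
      a.2.1 = adj B e g * p.1.1 * g ∧ IsKrylovPoint p (Hess.mk a : Hess B e k S) := by
  -- With `adj B e g` as the inverse, `g⁻¹ s g` is definitionally `adj B e g * s * g`, visibly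
  -- polynomial in `g` and `s`.
  let γ : V ≃ₗ[ℂ] V := LinearEquiv.ofLinearMap g (adj B e g) (he.mul_adj hg) (he.adj_mul hg)
  have hγ : γ ∈ SO B := ⟨hg, hdet⟩
  have hmap : ∀ l ≤ k, (stdFlag e l).map (γ : V →ₗ[ℂ] V) = krylov p.1.1 v l := fun l hl => by
    rw [stdFlag, Submodule.map_span, krylov]
    congr 1
    ext w
    constructor
    · rintro ⟨_, ⟨i, hi, rfl⟩, rfl⟩
      exact ⟨i, hi, hgv i (lt_of_lt_of_le hi hl)⟩
    · rintro ⟨i, hi, rfl⟩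
      exact ⟨_, ⟨⟨i, by omega⟩, hi, rfl⟩, hgv ⟨i, by omega⟩ (lt_of_lt_of_le hi hl)⟩
  have hs1 : p.1.1 ∈ g1 B := p.2.1.1
  have hy : γ⁻¹.conj p.1.1 ∈ S := hS _ (conj_mem_g1 (inv_mem hγ) hs1)
    (isHessenberg_of_map_stdFlag hs1 (fun i hi => p.2.2 i hi v hv) hk1 hγ
      (hmap _ (Nat.sub_le k 1)) (hmap k le_rfl))
  refine ⟨(⟨γ, hγ⟩, ⟨γ⁻¹.conj p.1.1, hy⟩), rfl, rfl, isKrylovPoint_of_mem hv hv0 ?_ ?_⟩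
  · exact conj_conj_inv γ p.1.1
  · exact Prod.ext (hmap _ (Nat.sub_le k 1)) (hmap k le_rfl)

end SplitPair

/-! ### Regularity of the correspondence -/

namespace SplitPair

open FunctionSpace

variable {V : Type*} [AddCommGroup V] [Module ℂ V] {N : ℕ}
  {B : LinearMap.BilinForm ℂ V} {e : Module.Basis (Fin N) ℂ V} {k m : ℕ}
  {S : Submodule ℂ (Module.End ℂ V)}

/-- `K × S` as a closed subvariety of the affine space `End V × End V`. -/
noncomputable def prodVariety (B : LinearMap.BilinForm ℂ V) (S : Submodule ℂ (Module.End ℂ V)) :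
    FunctionSpace (SO B × S) :=
  induced (fun a : SO B × S => (((a.1.1 : V →ₗ[ℂ] V) : Module.End ℂ V), (a.2 : Module.End ℂ V)))
    (affine (Module.End ℂ V × Module.End ℂ V))

theorem isLocal_prodVariety (B : LinearMap.BilinForm ℂ V) (S : Submodule ℂ (Module.End ℂ V)) :
    (prodVariety B S).IsLocal := (isLocal_affine _).induced _

theorem regularOn_prodVariety (B : LinearMap.BilinForm ℂ V) (S : Submodule ℂ (Module.End ℂ V)) :
    RegularOn (prodVariety B S) Set.univ
      (fun a => (((a.1.1 : V →ₗ[ℂ] V) : Module.End ℂ V), (a.2 : Module.End ℂ V))) :=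
  RegularOn.comp_induced (regularOn_affine_id _) (affine _).isOpen_univ _

/-- Elements of `S` already lie in `𝔤₁`, so the set is the nonvanishing locus of the regular
function `det χ'(y)`. -/
theorem isOpen_regularSemisimple [FiniteDimensional ℂ V] (hS : ∀ y ∈ S, y ∈ g1 B) :
    (prodVariety B S).IsOpen {a | a.2.1 ∈ g1rs B} := by
  let b := Module.finBasis ℂ V
  have h1 : {a : SO B × S | a.2.1 ∈ g1rs B} = {a | a ∈ Set.univ ∧
      (Polynomial.aeval (LinearMap.toMatrixAlgEquiv b a.2.1)
        (LinearMap.toMatrixAlgEquiv b a.2.1).charpoly.derivative).det ≠ 0} := by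
    ext a
    have h2 : (Polynomial.aeval (LinearMap.toMatrixAlgEquiv b a.2.1)
        (LinearMap.toMatrixAlgEquiv b a.2.1).charpoly.derivative).det =
        LinearMap.det (Polynomial.aeval a.2.1 a.2.1.charpoly.derivative) := by
      have h3 : (LinearMap.toMatrixAlgEquiv b a.2.1).charpoly = a.2.1.charpoly :=
        LinearMap.charpoly_toMatrix a.2.1 b
      rw [h3, ← LinearMap.det_toMatrix b]
      congr 1
      exact Polynomial.aeval_algHom_apply (LinearMap.toMatrixAlgEquiv b).toAlgHom a.2.1 _
    simp only [Set.mem_ofPred_eq, Set.mem_univ, true_and, h2]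
    rw [← ncard_eigenvalues_iff]
    exact ⟨fun h => h.2, fun h => ⟨hS _ a.2.2, h⟩⟩
  rw [h1]
  refine (isLocal_prodVariety B S).isOpen_ne_zero _ (prodVariety B S).isOpen_univ _
    (det_aeval_derivative_charpoly_regular fun i j => ?_)
  have h4 := ((regularOn_prodVariety B S).linear (LinearMap.snd ℂ _ _)).linear
    (LinearMap.toMatrixAlgEquiv b).toLinearMap
  exact (h4.linear (Matrix.entryLinearMap ℂ ℂ i j)).mem

theorem regularOn_krylovVec [FiniteDimensional ℂ V] {X : Type*} {A : FunctionSpace X} {D : Set X}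
    {y : X → Module.End ℂ V} (hy : RegularOn A D y) (hk1 : 1 ≤ k) (hk : 2 * k < N) :
    RegularOn A D fun x => krylovVec B e hk1 hk (y x) := by
  refine RegularOn.sum _ fun j _ => RegularOn.smul
    (adjugate_regular (M := fun x => krylovMatrix B e hk1 hk (y x)) (fun i j => ?_) _ _)
    (RegularOn.const _)
  exact (((hy.pow i).apply (RegularOn.const _)).linear (LinearMap.flip B (e ⟨N - k, by omega⟩))).mem

/-! #### From the family of quadrics to the Hessenberg variety -/

theorem isLocal_affineProjective (E V : Type*) [AddCommGroup E] [Module ℂ E] [AddCommGroup V]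
    [Module ℂ V] : (affineProjective E V).IsLocal :=
  ((isLocal_affine _).induced _).coinduced _

/-! ### Affine charts of projective space -/

section Chart

variable {E : Type*} [AddCommGroup E] [Module ℂ E]

/-- `rep` is an arbitrary choice, but the ratio of `l` to `lam` depends only on the line; this makes
the normalized representative regular. -/
theorem apply_rep_mk {F : Type*} [AddCommGroup F] [Module ℂ F] (l : V →ₗ[ℂ] F)
    (lam : Module.Dual ℂ V) {v : V} (hv : v ≠ 0) :
    (lam (Projectivization.mk ℂ v hv).rep)⁻¹ • l (Projectivization.mk ℂ v hv).rep =
      (lam v)⁻¹ • l v := by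
  obtain ⟨c, hc⟩ := Projectivization.exists_smul_eq_mk_rep ℂ v hv
  rw [← hc, Units.smul_def, map_smul, map_smul, smul_eq_mul, mul_inv, mul_comm, mul_smul,
    inv_smul_smul₀ c.ne_zero]

theorem apply_rep_mk_ne_zero_iff (lam : Module.Dual ℂ V) {v : V} (hv : v ≠ 0) :
    lam (Projectivization.mk ℂ v hv).rep ≠ 0 ↔ lam v ≠ 0 := by
  obtain ⟨c, hc⟩ := Projectivization.exists_smul_eq_mk_rep ℂ v hv
  rw [← hc, Units.smul_def, map_smul, smul_eq_mul]
  simp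

theorem regularOn_val (E V : Type*) [AddCommGroup E] [Module ℂ E] [AddCommGroup V] [Module ℂ V] :
    RegularOn (induced (Subtype.val : {p : E × V // p.2 ≠ 0} → E × V) (affine (E × V)))
      Set.univ (fun p => p.1) :=
  RegularOn.comp_induced (regularOn_affine_id _) (affine _).isOpen_univ _

/-- The affine chart of `ℙ(V)` on which the linear form `lam` does not vanish. -/
theorem isOpen_chart (lam : Module.Dual ℂ V) :
    (affineProjective E V).IsOpen {q | lam q.2.rep ≠ 0} := by
  have h := ((isLocal_affine (E × V)).induced Subtype.val).isOpen_ne_zero Set.univ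
    (FunctionSpace.isOpen_set_univ _) _
    (((regularOn_val E V).linear (LinearMap.snd ℂ E V)).linear lam).mem
  refine (congrArg (induced (Subtype.val : {p : E × V // p.2 ≠ 0} → E × V)
    (affine (E × V))).IsOpen ?_).mp h
  ext q
  exact (and_iff_right trivial).trans (apply_rep_mk_ne_zero_iff lam q.2).symm

theorem regularOn_fst : RegularOn (affineProjective E V) Set.univ Prod.fst := fun l =>
  (regularOn_val E V).linear (LinearMap.fst ℂ E V) l

theorem regularOn_normalized (lam : Module.Dual ℂ V) :
    RegularOn (affineProjective E V) {q | lam q.2.rep ≠ 0}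
      (fun q => (lam q.2.rep)⁻¹ • q.2.rep) := by
  intro l
  have hA := (isLocal_affine (E × V)).induced (Subtype.val : {p : E × V // p.2 ≠ 0} → E × V)
  have hO := isOpen_chart (E := E) lam
  have h0 := ((regularOn_val E V).linear (LinearMap.snd ℂ E V)).restrict
    (FunctionSpace.isOpen_set_univ _) hO (Set.subset_univ _)
  have h1 := mul_mem (hA.inv_mem _ hO _ (h0 lam) fun q hq =>
    (apply_rep_mk_ne_zero_iff lam q.2).1 hq) (h0 l)
  refine FunctionSpace.regular_congr (induced _ (affine (E × V))) hO h1 fun q _ => ?_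
  have h2 := apply_rep_mk l lam q.2
  simp only [smul_eq_mul] at h2
  simpa using h2

end Chart

theorem isLocal_quadricFamily (B : LinearMap.BilinForm ℂ V) (m : ℕ) :
    (QuadricFamily.variety B m).IsLocal := (isLocal_affineProjective _ _).induced _

/-- Normalizing `v` by a linear form gives a regular isotropic frame `v, …, s^(k-1) v`. The
parametric Witt theorem supplies a regular `g` carrying the standard frame to it, and `(g, g⁻¹ s g)`
is the section. -/
theorem exists_local_section [FiniteDimensional ℂ V] (he : IsSplitBasis B e)
    (hk1 : 1 ≤ k) (hk : 2 * k < N) (hm : 2 * k ≤ m + 1)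
    (hS : ∀ y ∈ g1 B, IsHessenberg B e k m y → y ∈ S) (p₀ : QuadricFamily B m) :
    ∃ D, p₀ ∈ D ∧ ∃ σ : QuadricFamily B m → SO B × S,
      IsMorphismOn (QuadricFamily.variety B m) (prodVariety B S) D σ ∧
        ∀ p ∈ D, IsKrylovPoint p (Hess.mk (σ p) : Hess B e k S) := by
  have hA := isLocal_quadricFamily B m
  obtain ⟨lam, hlam⟩ : ∃ lam : Module.Dual ℂ V, lam p₀.1.2.rep ≠ 0 := by
    by_contra! h
    exact p₀.1.2.rep_nonzero ((Module.forall_dual_apply_eq_zero_iff ℂ _).1 h)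
  let D₀ : Set (QuadricFamily B m) := {p | lam p.1.2.rep ≠ 0}
  have hD₀ : (QuadricFamily.variety B m).IsOpen D₀ :=
    isOpen_induced (isOpen_chart (E := Module.End ℂ V) lam)
  let v : QuadricFamily B m → V := fun p => (lam p.1.2.rep)⁻¹ • p.1.2.rep
  have hv : RegularOn (QuadricFamily.variety B m) D₀ v :=
    RegularOn.comp_induced (regularOn_normalized lam) (isOpen_chart lam) _
  have hs : RegularOn (QuadricFamily.variety B m) D₀ fun p => p.1.1 :=
    (RegularOn.comp_induced (regularOn_fst (E := Module.End ℂ V) (V := V))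
      (FunctionSpace.isOpen_set_univ _) _).restrict (FunctionSpace.isOpen_set_univ _) hD₀
        (Set.subset_univ _)
  have hvmem : ∀ p : QuadricFamily B m, v p ∈ p.1.2.submodule := fun p =>
    Submodule.smul_mem _ _ (rep_mem_submodule _)
  have hv0 : ∀ p ∈ D₀, v p ≠ 0 := fun p hp =>
    smul_ne_zero (inv_ne_zero hp) p.1.2.rep_nonzero
  have hiso : ∀ p : QuadricFamily B m, ∀ i < k, ∀ j < k,
      B ((p.1.1 ^ i) (v p)) ((p.1.1 ^ j) (v p)) = 0 := fun p i hi j hj => by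
    rw [apply_pow_pow p.2.1.1.2]
    exact p.2.2 _ (by omega) _ (hvmem p)
  obtain ⟨D, hDD₀, hD, hpD, g, hg, hg'⟩ := he.exists_local_isometry hA hk
    (w := fun i p => (p.1.1 ^ i) (v p)) hD₀ (fun i _ => (hs.pow i).apply hv)
    (fun p _ => hiso p) (x₀ := p₀) hlam (fun j hj => by
      have h1 := pow_notMem_krylov he p₀.2.1 (hv0 p₀ hlam) (hiso p₀) hj
      have h2 : (fun i => (p₀.1.1 ^ i) (v p₀)) '' {i | i < j} =
          {w | ∃ i < j, w = (p₀.1.1 ^ i) (v p₀)} := by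
        ext w
        exact ⟨fun ⟨i, hi, h⟩ => ⟨i, hi, h.symm⟩, fun ⟨i, hi, h⟩ => ⟨i, hi, h.symm⟩⟩
      rw [h2]
      exact h1) le_rfl
  have hex : ∀ p, ∃ a : SO B × S, p ∈ D → ((a.1.1 : V →ₗ[ℂ] V) : Module.End ℂ V) = g p ∧
      a.2.1 = adj B e (g p) * p.1.1 * g p ∧ IsKrylovPoint p (Hess.mk a : Hess B e k S) := by
    intro p
    by_cases hp : p ∈ D
    · obtain ⟨h1, h2, h3⟩ := hg' p hp
      obtain ⟨a, ha⟩ := exists_isKrylovPoint_of_isIsometry he hk1 hk hS p (hvmem p)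
        (hv0 p (hDD₀ hp)) h1 h2 h3
      exact ⟨a, fun _ => ha⟩
    · exact ⟨(1, 0), fun h => absurd h hp⟩
  choose σ hσ using hex
  have hsD := hs.restrict hD₀ hD hDD₀
  have hreg := hg.prodMk (((hg.linear (adj B e)).mul hsD).mul hg)
  refine ⟨D, hpD, σ, IsMorphismOn.toInduced ((hreg.isMorphismOn hA hD).congr fun p hp => ?_),
    fun p hp => (hσ p hp).2.2⟩
  exact Prod.ext (hσ p hp).1 (hσ p hp).2.1

/-! #### From the Hessenberg variety to the family of quadrics -/

/-- By the definition of the quotient structure, regularity may be checked on `K × S`. There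
uniqueness of the generator identifies the map with `(g, y) ↦ (g y g⁻¹, ⟨g v⟩)`, where `v` is the
polynomial generator for `y`. -/
theorem isMorphism_symm [FiniteDimensional ℂ V] (he : IsSplitBasis B e)
    (hk1 : 1 ≤ k) (hk : 2 * k < N) (hm : m ≤ 2 * k)
    (hS : ∀ y ∈ S, y ∈ g1 B ∧ IsHessenberg B e k m y)
    (Ψ : HessRS B e k S → QuadricFamily B m) (hΨ : ∀ h, IsKrylovPoint (Ψ h) h.1) :
    IsMorphism (HessRS.variety B e k S) (QuadricFamily.variety B m) Ψ := by
  classical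
  rcases isEmpty_or_nonempty (HessRS B e k S) with hE | ⟨⟨h₀⟩⟩
  · exact IsMorphismOn.glue fun h => hE.elim h
  have hrs : ∀ a : SO B × S, (Hess.mk a : Hess B e k S) ∈ HessRS B e k S ↔ a.2.1 ∈ g1rs B :=
    fun a => ⟨fun h => by
      have h1 := conj_mem_g1rs (a.1⁻¹).2 (show a.1.1.conj a.2.1 ∈ g1rs B from h)
      rwa [← conj_inv_conj a.1.1 a.2.1], fun h => conj_mem_g1rs a.1.2 h⟩
  -- The value off the regular semisimple locus is arbitrary; a total map is needed to pass through
  -- the quotient.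
  let Ψ' : Hess B e k S → QuadricFamily B m := fun h =>
    if hr : h ∈ HessRS B e k S then Ψ ⟨h, hr⟩ else Ψ h₀
  have hΨ' : Ψ = Ψ' ∘ Subtype.val := by
    ext1 h
    change Ψ h = if hr : h.1 ∈ HessRS B e k S then Ψ ⟨h.1, hr⟩ else Ψ h₀
    rw [dif_pos h.2]
  rw [hΨ']
  refine IsMorphismOn.ofInduced (D := HessRS B e k S) (IsMorphismOn.ofCoinduced
    (IsMorphismOn.toInduced ?_)) fun h => h.2
  have hO : Hess.mk ⁻¹' HessRS B e k S = {a : SO B × S | a.2.1 ∈ g1rs B} := Set.ext hrs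
  rw [hO]
  let φ : SO B × S → {p : Module.End ℂ V × V // p.2 ≠ 0} := fun a =>
    if h0 : a.1.1 (krylovVec B e hk1 hk a.2.1) ≠ 0 then
      ⟨(a.1.1.conj a.2.1, a.1.1 (krylovVec B e hk1 hk a.2.1)), h0⟩
    else ⟨((Ψ h₀).1.1, (Ψ h₀).1.2.rep), (Ψ h₀).1.2.rep_nonzero⟩
  have hopen := isOpen_regularSemisimple (B := B) fun y hy => (hS y hy).1
  have hreg := (regularOn_prodVariety B S).restrict (FunctionSpace.isOpen_set_univ _) hopen
    (Set.subset_univ _)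
  have hg := hreg.linear (LinearMap.fst ℂ _ _)
  have hy := hreg.linear (LinearMap.snd ℂ _ _)
  have hφ : IsMorphismOn (prodVariety B S)
      (induced Subtype.val (affine (Module.End ℂ V × V))) {a | a.2.1 ∈ g1rs B} φ := by
    refine IsMorphismOn.toInduced ((((((hg.mul hy).mul (hg.linear (adj B e)))).prodMk
      (hg.apply (regularOn_krylovVec (B := B) (e := e) hy hk1 hk))).isMorphismOn
        (isLocal_prodVariety B S) hopen).congr fun a ha => ?_)
    obtain ⟨h0, -⟩ := apply_pow_krylovVec_conj he hk1 hk hm a ha (hS _ a.2.2).2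
    have h1 : φ a = ⟨(a.1.1.conj a.2.1, a.1.1 (krylovVec B e hk1 hk a.2.1)), h0⟩ := dif_pos h0
    rw [Function.comp_apply, h1]
    refine Prod.ext ?_ rfl
    have h2 : ((a.1.1.symm : V →ₗ[ℂ] V) : Module.End ℂ V) = adj B e (a.1.1 : V →ₗ[ℂ] V) := by
      have h3 := he.adj_mul (g := (a.1.1 : V →ₗ[ℂ] V)) a.1.2.1
      ext z
      have h4 := LinearMap.congr_fun h3 (a.1.1.symm z)
      rw [Module.End.mul_apply] at h4
      refine h4.symm.trans ?_
      exact congrArg _ (a.1.1.apply_symm_apply z)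
    change _ = (_ * _) * adj B e (a.1.1 : V →ₗ[ℂ] V)
    rw [← h2]
    rfl
  refine (hφ.toCoinduced _).congr fun a ha => ?_
  obtain ⟨h0, hmem⟩ := apply_pow_krylovVec_conj he hk1 hk hm a ha (hS _ a.2.2).2
  have h1 : φ a = ⟨(a.1.1.conj a.2.1, a.1.1 (krylovVec B e hk1 hk a.2.1)), h0⟩ := dif_pos h0
  have hr := (hrs a).2 ha
  have h2 : Ψ' (Hess.mk a) = Ψ ⟨Hess.mk a, hr⟩ := dif_pos hr
  have h3 : Ψ ⟨Hess.mk a, hr⟩ = ⟨_, hmem⟩ :=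
    (hΨ ⟨Hess.mk a, hr⟩).left_unique he hk1 hk (fun y hy => (hS y hy).2)
      (isKrylovPoint_krylovVec he hk1 hk a ha (hS _ a.2.2).2 _ rfl (mem_submodule_mk h0))
  simp only [Function.comp_apply, h1, h2, h3]

/-- `IsKrylovPoint` is a `K`-stable relation, total and unique on both sides, hence the graph of an
equivariant bijection. The bounds on `m` allow exactly `2k - 1` and `2k`. -/
theorem exists_isKrylovIsomorphism [FiniteDimensional ℂ V] (he : IsSplitBasis B e)
    (hk1 : 1 ≤ k) (hk : 2 * k < N) (hm : 2 * k ≤ m + 1) (hm' : m ≤ 2 * k)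
    (hS : ∀ y, y ∈ S ↔ y ∈ g1 B ∧ IsHessenberg B e k m y) :
    ∃ Φ : QuadricFamily B m ≃ HessRS B e k S, IsKrylovIsomorphism B e k S Φ := by
  have hS' := fun y hy => (hS y).1 hy
  have hsec := exists_local_section (S := S) he hk1 hk hm fun y h1 h2 => (hS y).2 ⟨h1, h2⟩
  have hΦ : ∀ p : QuadricFamily B m, ∃ h : HessRS B e k S, IsKrylovPoint p h.1 := fun p => by
    obtain ⟨D, hpD, σ, -, hσ⟩ := hsec p
    refine ⟨⟨Hess.mk (σ p), ?_⟩, hσ p hpD⟩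
    change Hess.proj _ ∈ g1rs B
    rw [(hσ p hpD).1]
    exact p.2.1
  have hΨ : ∀ h : HessRS B e k S, ∃ p : QuadricFamily B m, IsKrylovPoint p h.1 := by
    rintro ⟨⟨a⟩, hr⟩
    have h1 := conj_mem_g1rs (a.1⁻¹).2 (show a.1.1.conj a.2.1 ∈ g1rs B from hr)
    have ha : a.2.1 ∈ g1rs B := by rwa [← conj_inv_conj a.1.1 a.2.1]
    obtain ⟨h0, hmem⟩ := apply_pow_krylovVec_conj he hk1 hk hm' a ha (hS' _ a.2.2).2
    exact ⟨⟨_, hmem⟩, isKrylovPoint_krylovVec he hk1 hk a ha (hS' _ a.2.2).2 _ rfl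
      (mem_submodule_mk h0)⟩
  choose Φ hΦ using hΦ
  choose Ψ hΨ using hΨ
  have hu := fun (p : QuadricFamily B m) (h h' : HessRS B e k S) (H : IsKrylovPoint p h.1)
    (H' : IsKrylovPoint p h'.1) => Subtype.ext (H.right_unique H')
  refine ⟨⟨Φ, Ψ, fun p => (hΨ _).left_unique he hk1 hk (fun y hy => (hS' y hy).2) (hΦ p),
    fun h => hu _ _ _ (hΦ _) (hΨ h)⟩, ⟨⟨?_, ?_⟩, fun p => Subtype.ext (hΦ p).1,
      fun κ p => hu _ _ _ (hΦ _) ((hΦ p).smul κ), fun p => (hΦ p).2⟩⟩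
  · refine IsMorphismOn.glue fun p => ?_
    obtain ⟨D, hpD, σ, hσ, hσ'⟩ := hsec p
    exact ⟨D, hpD, IsMorphismOn.toInduced ((hσ.toCoinduced _).congr fun p hp =>
      (hΦ p).right_unique (hσ' p hp))⟩
  · exact isMorphism_symm he hk1 hk hm' hS' Ψ hΨ

end SplitPair

theorem theorem2 {V : Type*} [AddCommGroup V] [Module ℂ V] {N : ℕ}
    (B : LinearMap.BilinForm ℂ V) (e : Module.Basis (Fin N) ℂ V)
    (he : ∀ i j : Fin N, B (e i) (e j) = if (i : ℕ) + (j : ℕ) + 1 = N then 1 else 0)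
    (k : ℕ) (hk : 1 ≤ k) (hkN : (k : ℚ) ≤ ((N : ℚ) - 1) / 2) :
    (∃ Φ : SplitPair.QuadricFamily B (2 * k - 1) ≃
        SplitPair.HessRS B e k (SplitPair.tracePerp B (SplitPair.Ospace B e k)),
      SplitPair.IsKrylovIsomorphism B e k
        (SplitPair.tracePerp B (SplitPair.Ospace B e k)) Φ) ∧
    (∃ Φ : SplitPair.QuadricFamily B (2 * k) ≃
        SplitPair.HessRS B e k (SplitPair.tracePerp B (SplitPair.Espace B e k)),
      SplitPair.IsKrylovIsomorphism B e k
        (SplitPair.tracePerp B (SplitPair.Espace B e k)) Φ) := by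
  have := e.finiteDimensional_of_finite
  have hkN' : 2 * k < N := by
    have h1 : (2 * k + 1 : ℚ) ≤ N := by linarith
    exact_mod_cast h1
  have he' : SplitPair.IsSplitBasis B e := he
  constructor
  · refine SplitPair.exists_isKrylovIsomorphism he' hk hkN' (by omega) (by omega) fun y => ?_
    rw [SplitPair.mem_tracePerp_Ospace he' hkN'.le]
    -- For `m = 2k - 1` the second Hessenberg condition is vacuous.
    exact ⟨fun h => ⟨h.1, h.2, fun h' => by omega⟩, fun h => ⟨h.1, h.2.apply_mem⟩⟩
  · refine SplitPair.exists_isKrylovIsomorphism he' hk hkN' (by omega) (by omega) fun y => ?_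
    rw [SplitPair.mem_tracePerp_Espace he' hkN'.le]
    exact ⟨fun h => ⟨h.1, h.2.1, fun _ => h.2.2⟩,
      fun h => ⟨h.1, h.2.apply_mem, h.2.apply_eq_zero le_rfl⟩⟩
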